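/- Consider a $d$-level quantum system ($d\ge 1$) with Hamiltonian $H=\sum_{i=0}^{d-1}E_i|i\rangle\langle i|$, $E_0\le E_i$ for all $i$, ground state $|0\rangle$, at temperature $T>0$. Let $k>0$ be the Boltzmann constant and let $\Gamma=e^{-H/kT}/\mathrm{Tr}\,e^{-H/kT}$ be the Gibbs state. Logarithms $\log$ are in base 2. The free energy of a state is $A(\rho)=\mathrm{Tr}[H\rho]+kT\,\mathrm{Tr}[\rho\ln\rho]$, and $\Delta A=A(|0\rangle\langle 0|)-A(\Gamma)$. **Costs of a channel.** An information battery is an array of $n$ qubits ($n$ arbitrary) with zero Hamiltonian, in a state $\tau_S$ that is maximally mixed on the span of a nonempty set $S$ of computational basis vectors; it contains $n-\log|S|$ clean qubits. An operation $\Phi$ on system and battery implements a channel $\mathcal M$ on the system with consumption $\log|S'|-\log|S|$ if $\Phi(\rho\otimes\tau_S)=\mathcal M(\rho)\otimes\tau_{S'}$ for all $\rho$. The nonequilibrium cost $c(\mathcal M)$ is the infimum of the consumption over all implementations by Gibbs preserving operations (channels that fix the joint Gibbs state $\Gamma\otimes I/2^n$). The work cost $W(\mathcal M)$ is $kT\ln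 2$ times the infimum of the consumption over all implementations by thermal operations, i.e. maps $\sigma\mapsto\mathrm{Tr}_{\rm bath}[U(\sigma\otimes\gamma)U^\dagger]$, where the bath is any (possibly infinite-dimensional) system that has a Gibbs state $\gamma$ at temperature $T$ and $U$ is a unitary that commutes with the total Hamiltonian ($W(\mathcal M)=+\infty$ if there is no such implementation). **Erasure.** The accuracy of a channel $\mathcal M$ is the worst-case fidelity $F_{\rm erase}(\mathcal M)=\min_{\psi}\langle 0|\mathcal M(|\psi\rangle\langle\psi|)|0\rangle$ over all unit vectors $\psi$. Put $c_{\rm erase}(F)=\min\{c(\mathcal M): F_{\rm erase}(\mathcal M)\ge F\}$ and $W_{\rm erase}(F)=\min\{W(\mathcal M): F_{\rm erase}(\mathcal M)\ge F\}$. The reverse entropy is $$\kappa_{\rm erase}=-\log\ \max_{\mathcal M}\ \inf_{\psi}\ \mathrm{Tr}\big[\Gamma^{-1/2}|\psi\rangle\langle\psi|\Gamma^{-1/2}\,\mathcal M(\Gamma^{1/2}|0\rangle\langle 0|\Gamma^{1/2})\big],$$ the maximum being over all channels. Let $F_{\max}$ be the largest accuracy of a channel, and $F_{\min}$ the largest accuracy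 of a channel of minimum nonequilibrium cost. **Claim.** $\kappa_{\rm erase}=\dfrac{\Delta A}{kT\ln 2}$, $F_{\max}=1$, $F_{\min}=2^{-\kappa_{\rm erase}}=e^{-\Delta A/(kT)}$, both extremal accuracies being attained, and for every $F\in[F_{\min},F_{\max}]$ the minima defining $c_{\rm erase}(F)$ and $W_{\rm erase}(F)$ are attained and $$c_{\rm erase}(F)=\kappa_{\rm erase}+\log F=\frac{\Delta A}{kT\ln 2}+\log F,\qquad W_{\rm erase}(F)=kT\ln 2\; c_{\rm erase}(F)=\Delta A+kT\ln F .$$ -/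

import Mathlib

open scoped Matrix ComplexOrder

noncomputable section

namespace ErasureCost

/-! ## Quantum channels on finite-dimensional systems -/

/-- Complete positivity: every extension of `Φ` by the identity on a `k`-dimensional reference
system maps positive semidefinite matrices to positive semidefinite matrices. -/
def IsCompletelyPositive {α β : Type} [Fintype α] [Fintype β]
    (Φ : Matrix α α ℂ →ₗ[ℂ] Matrix β β ℂ) : Prop :=
  ∀ (k : ℕ) (R : Matrix (Fin k × α) (Fin k × α) ℂ), R.PosSemidef →
    (Matrix.of fun p q : Fin k × β =>
      Φ (Matrix.of fun a b => R (p.1, a) (q.1, b)) p.2 q.2).PosSemidef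

/-- A quantum channel: a completely positive trace-preserving linear map. -/
def IsChannel {α β : Type} [Fintype α] [Fintype β]
    (Φ : Matrix α α ℂ →ₗ[ℂ] Matrix β β ℂ) : Prop :=
  IsCompletelyPositive Φ ∧ ∀ ρ, (Φ ρ).trace = ρ.trace

/-! ## Gibbs states and free energy

A system is given by its energy levels `E : ι → ℝ`; matrices are written in the corresponding
orthonormal energy eigenbasis, so that the Hamiltonian is `diagonal E`. -/

/-- Gibbs probabilities `exp (-E i / kT) / Z` (the index set may be infinite). -/
def gibbsWeight {ι : Type} (kT : ℝ) (E : ι → ℝ) (i : ι) : ℝ :=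
  Real.exp (-E i / kT) / ∑' j, Real.exp (-E j / kT)

/-- The Hamiltonian, in its eigenbasis. -/
def hamiltonian {α : Type} [DecidableEq α] (E : α → ℝ) : Matrix α α ℂ :=
  Matrix.diagonal fun i => (E i : ℂ)

/-- The Gibbs state `Γ`. -/
def gibbsState {α : Type} [DecidableEq α] (kT : ℝ) (E : α → ℝ) : Matrix α α ℂ :=
  Matrix.diagonal fun i => (gibbsWeight kT E i : ℂ)

/-- The operator `Γ ^ (1/2)`. -/
def gibbsSqrt {α : Type} [DecidableEq α] (kT : ℝ) (E : α → ℝ) : Matrix α α ℂ :=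
  Matrix.diagonal fun i => ((Real.sqrt (gibbsWeight kT E i) : ℝ) : ℂ)

/-- The operator `Γ ^ (-1/2)`. -/
def gibbsInvSqrt {α : Type} [DecidableEq α] (kT : ℝ) (E : α → ℝ) : Matrix α α ℂ :=
  Matrix.diagonal fun i => (((Real.sqrt (gibbsWeight kT E i))⁻¹ : ℝ) : ℂ)

/-- The von Neumann entropy `S(ρ) = - Tr [ρ ln ρ]` (in nats). -/
def entropy {α : Type} [Fintype α] [DecidableEq α] (ρ : Matrix α α ℂ) : ℝ :=
  (cfc Real.negMulLog ρ).trace.re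

/-- The free energy `A(ρ) = Tr [H ρ] - kT S(ρ)`. -/
def freeEnergy {α : Type} [Fintype α] [DecidableEq α] (kT : ℝ) (E : α → ℝ)
    (ρ : Matrix α α ℂ) : ℝ :=
  (hamiltonian E * ρ).trace.re - kT * entropy ρ

/-! ## Free operations -/

/-- Gibbs preserving operations on a system with energy levels `E`. -/
def IsGibbsPreserving {α : Type} [Fintype α] [DecidableEq α] (kT : ℝ) (E : α → ℝ)
    (Φ : Matrix α α ℂ →ₗ[ℂ] Matrix α α ℂ) : Prop :=
  IsChannel Φ ∧ Φ (gibbsState kT E) = gibbsState kT E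

/-- For a matrix `U` on the tensor product of a system (index `α`) and a bath (index `ι`), the
operator `⟨e| U |f⟩` on the system, where `|e⟩`, `|f⟩` are bath basis vectors. -/
def bathBlock {α ι : Type} (U : Matrix (α × ι) (α × ι) ℂ) (e f : ι) : Matrix α α ℂ :=
  Matrix.of fun a b => U (a, e) (b, f)

/-- Thermal operations: `Φ ρ = Tr_bath [U (ρ ⊗ γ) U†]`, where the bath is any system that has a
Gibbs state `γ` (possibly infinite-dimensional; `ω` lists its energies in an eigenbasis) and `U`
is a unitary that commutes with the total Hamiltonian, i.e. has matrix elements only between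
energy eigenvectors of equal total energy. A convergent partition function makes every total
energy finitely degenerate, so rows and columns of `U` have finite support, and the operators
`√γ_f ⟨e|U|f⟩` are Kraus operators of `Φ`. -/
def IsThermalOperation {α : Type} [Fintype α] [DecidableEq α] (kT : ℝ) (E : α → ℝ)
    (Φ : Matrix α α ℂ →ₗ[ℂ] Matrix α α ℂ) : Prop :=
  ∃ (ι : Type) (ω : ι → ℝ) (U : Matrix (α × ι) (α × ι) ℂ),
    Nonempty ι ∧
    Summable (fun e => Real.exp (-ω e / kT)) ∧
    (∀ p q, E p.1 + ω p.2 ≠ E q.1 + ω q.2 → U p q = 0) ∧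
    (∀ p, HasSum (fun r => U p r * star (U p r)) 1) ∧
    (∀ p q, p ≠ q → HasSum (fun r => U p r * star (U q r)) 0) ∧
    (∀ p, HasSum (fun r => star (U r p) * U r p) 1) ∧
    (∀ p q, p ≠ q → HasSum (fun r => star (U r p) * U r q) 0) ∧
    ∀ ρ : Matrix α α ℂ, HasSum
      (fun p : ι × ι =>
        (gibbsWeight kT ω p.2 : ℂ) • (bathBlock U p.1 p.2 * ρ * (bathBlock U p.1 p.2)ᴴ))
      (Φ ρ)

/-! ## Information battery -/

/-- Computational basis of an array of `n` qubits. -/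
abbrev Qubits (n : ℕ) : Type := Fin n → Fin 2

/-- Energy levels of system and battery; the battery qubits are degenerate, with energy zero. -/
def withBattery {α : Type} (E : α → ℝ) (n : ℕ) : α × Qubits n → ℝ := fun p => E p.1

/-- The battery state that is maximally mixed on the span of the basis vectors in `S`. If `S` is
the set of bit strings that vanish at `m` given places, these `m` qubits are clean (pure) and the
others are maximally mixed. -/
def batteryState {n : ℕ} (S : Finset (Qubits n)) : Matrix (Qubits n) (Qubits n) ℂ :=
  Matrix.diagonal fun x => if x ∈ S then ((S.card : ℂ)⁻¹) else 0

/-- The number of clean qubits contained in `batteryState S` (fractional if the cardinality of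
`S` is not a power of two). -/
def cleanQubits {n : ℕ} (S : Finset (Qubits n)) : ℝ := n - Real.logb 2 S.card

/-- `Φ`, acting on system and battery, implements `M` on the system while it changes the state of
the battery from `batteryState S` to `batteryState S'`. -/
def Implements {α : Type} {n : ℕ}
    (Φ : Matrix (α × Qubits n) (α × Qubits n) ℂ →ₗ[ℂ] Matrix (α × Qubits n) (α × Qubits n) ℂ)
    (S S' : Finset (Qubits n)) (M : Matrix α α ℂ →ₗ[ℂ] Matrix α α ℂ) : Prop :=
  ∀ ρ : Matrix α α ℂ,
    Φ (Matrix.kroneckerMap (· * ·) ρ (batteryState S)) =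
      Matrix.kroneckerMap (· * ·) (M ρ) (batteryState S')

variable {α : Type} [Fintype α] [DecidableEq α]

/-- The nonequilibrium cost of `M`: the minimum (infimum) number of clean qubits consumed by an
implementation of `M` by a Gibbs preserving operation on system and battery. -/
def neqCost (kT : ℝ) (E : α → ℝ) (M : Matrix α α ℂ →ₗ[ℂ] Matrix α α ℂ) : EReal :=
  sInf {c | ∃ (n : ℕ) (S S' : Finset (Qubits n))
    (Φ : Matrix (α × Qubits n) (α × Qubits n) ℂ →ₗ[ℂ] Matrix (α × Qubits n) (α × Qubits n) ℂ),
    S.Nonempty ∧ S'.Nonempty ∧ IsGibbsPreserving kT (withBattery E n) Φ ∧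
    Implements Φ S S' M ∧ c = ((cleanQubits S - cleanQubits S' : ℝ) : EReal)}

/-- The work cost of `M`: `kT ln 2` times the minimum (infimum) number of clean qubits consumed by
an implementation of `M` by a thermal operation on system and battery (`⊤` if there is none). -/
def workCost (kT : ℝ) (E : α → ℝ) (M : Matrix α α ℂ →ₗ[ℂ] Matrix α α ℂ) : EReal :=
  sInf {w | ∃ (n : ℕ) (S S' : Finset (Qubits n))
    (Φ : Matrix (α × Qubits n) (α × Qubits n) ℂ →ₗ[ℂ] Matrix (α × Qubits n) (α × Qubits n) ℂ),
    S.Nonempty ∧ S'.Nonempty ∧ IsThermalOperation kT (withBattery E n) Φ ∧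
    Implements Φ S S' M ∧
    w = ((kT * Real.log 2 * (cleanQubits S - cleanQubits S') : ℝ) : EReal)}

/-- The minimum nonequilibrium cost of an arbitrary channel. -/
def minNeqCost (kT : ℝ) (E : α → ℝ) : EReal :=
  sInf {c | ∃ M : Matrix α α ℂ →ₗ[ℂ] Matrix α α ℂ, IsChannel M ∧ c = neqCost kT E M}

/-! ## Tasks -/

/-- An information processing task: the input states `ρ_x` and the observables `O_x` by which the
corresponding outputs are assessed. The input subspace is the whole Hilbert space. -/
structure Task (α : Type) where
  X : Type
  input : X → Matrix α α ℂ
  observable : X → Matrix α α ℂ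

/-- The worst-case accuracy `min_x Tr [O_x M(ρ_x)]`. -/
def Task.accuracy (𝒯 : Task α) (M : Matrix α α ℂ →ₗ[ℂ] Matrix α α ℂ) : ℝ :=
  ⨅ x, (𝒯.observable x * M (𝒯.input x)).trace.re

/-- The time-reversed task: inputs `Γ^(1/2) O_x Γ^(1/2)`, observables `Γ^(-1/2) ρ_x Γ^(-1/2)`. -/
def Task.reverse (kT : ℝ) (E : α → ℝ) (𝒯 : Task α) : Task α where
  X := 𝒯.X
  input x := gibbsSqrt kT E * 𝒯.observable x * gibbsSqrt kT E
  observable x := gibbsInvSqrt kT E * 𝒯.input x * gibbsInvSqrt kT E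

/-- The reverse entropy: minus the logarithm of the maximum accuracy, over all channels, in the
time-reversed task. -/
def Task.reverseEntropy (kT : ℝ) (E : α → ℝ) (𝒯 : Task α) : ℝ :=
  -Real.logb 2 (sSup {f | ∃ M : Matrix α α ℂ →ₗ[ℂ] Matrix α α ℂ,
    IsChannel M ∧ f = (𝒯.reverse kT E).accuracy M})

/-- The nonequilibrium costs of the channels that achieve accuracy at least `F`. -/
def Task.neqCosts (kT : ℝ) (E : α → ℝ) (𝒯 : Task α) (F : ℝ) : Set EReal :=
  {c | ∃ M : Matrix α α ℂ →ₗ[ℂ] Matrix α α ℂ,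
    IsChannel M ∧ F ≤ 𝒯.accuracy M ∧ c = neqCost kT E M}

/-- The work costs of the channels that achieve accuracy at least `F`. -/
def Task.workCosts (kT : ℝ) (E : α → ℝ) (𝒯 : Task α) (F : ℝ) : Set EReal :=
  {w | ∃ M : Matrix α α ℂ →ₗ[ℂ] Matrix α α ℂ,
    IsChannel M ∧ F ≤ 𝒯.accuracy M ∧ w = workCost kT E M}

/-- The nonequilibrium cost of accuracy `F`. -/
def Task.neqCostOf (kT : ℝ) (E : α → ℝ) (𝒯 : Task α) (F : ℝ) : EReal :=
  sInf (𝒯.neqCosts kT E F)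

/-- The work cost of accuracy `F`. -/
def Task.workCostOf (kT : ℝ) (E : α → ℝ) (𝒯 : Task α) (F : ℝ) : EReal :=
  sInf (𝒯.workCosts kT E F)

/-- The projector `|i⟩⟨i|` on a basis vector. -/
def basisState (i : α) : Matrix α α ℂ := Matrix.single i i 1

/-- Erasure to `|i⟩`: the inputs are all pure states `|ψ⟩⟨ψ|`, the target is `|i⟩⟨i|`, and the
figure of merit is the fidelity with `|i⟩`. -/
def erasure (i : α) : Task α where
  X := {ψ : EuclideanSpace ℂ α // ‖ψ‖ = 1}
  input ψ := Matrix.vecMulVec (fun a => ψ.1 a) (fun a => star (ψ.1 a))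
  observable _ := basisState i

/-- The difference between the free energy of `|i⟩⟨i|` and that of the Gibbs state. -/
def freeEnergyGap (kT : ℝ) (E : α → ℝ) (i : α) : ℝ :=
  freeEnergy kT E (basisState i) - freeEnergy kT E (gibbsState kT E)

end ErasureCost

end

/-!
Write `Γ_a` for the Gibbs weight of the energy level `a`, and `i` for the ground state. The free
energy gap is the surprisal of the ground state, `ΔA = -kT ln Γ_i` (`freeEnergyGap_eq`), and so is
the reverse entropy, up to the unit: the reversed task asks for the state `σ` with the largest
minimal eigenvalue of `Γ^(-1/2) σ Γ^(-1/2)`, which is `σ = Γ` (`reverseEntropy_erasure`). All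
claims thus follow from the fact that accuracy `F` costs exactly `log (F / Γ_i)` clean qubits.

*Lower bound.* If a Gibbs preserving operation implements `M` with battery sets `S` and `S'`, it
preserves the inequality `(|S| / 2 ^ n) Γ ⊗ τ_S ≤ Γ ⊗ I / 2 ^ n`, which gives
`M Γ ≤ (|S'| / |S|) Γ` (`Implements.apply_gibbsState_le`). The left hand side has at least the accuracy of `M` as its
matrix element at the ground state, since `Γ` is a mixture of pure states. The trace of the same
inequality shows that no channel has negative cost. Thermal operations are Gibbs preserving
(`IsThermalOperation.isGibbsPreserving`), so the bound applies to them too.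

*Achievability.* The channel `ρ ↦ Tr ρ • (r Γ + (1 - r) |i⟩⟨i|)`, where `r` is chosen such that
the accuracy is `F`, is implemented by thermal operations whose consumption approaches the bound
(`exists_thermal_implements_erasureChannel`). The unitary is a permutation of energy eigenvectors.
It exchanges the system with a bath copy of it, which removes all dependence on the input, and the
battery with a uniformly distributed register, which removes all correlations
(`exists_thermal_implements_trace_smul`). In between, it maps the states `(b, x)` of system and
battery, where `x` is one of `u` labels, injectively to states `(i, (b, y))` where `y` is one of
`v b` labels, while the bath takes up the energy `E b - E i`. An exact map of this kind exists as
soon as `v b > u exp (-(E b - E i) / kT)`, because the bath may be an infinite ladder whose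
degeneracies grow slightly more slowly than its inverse Boltzmann factors (`exists_raising_bath`).
As `∑ b, exp (-(E b - E i) / kT) = 1 / Γ_i`, this erases the system at a consumption close to
`log (1 / Γ_i)`. For `r > 0` a fraction close to `r` of the battery labels is left out of the map, and
a coin in the bath, the bias of which can be any real number, makes the accuracy exact
(`exists_erasing_permutation`).
-/

noncomputable section

namespace ErasureCost

/-! ### Gibbs weights, entropy and free energy -/

section Gibbs

variable {ι κ : Type} {kT : ℝ} {E : ι → ℝ}

theorem partitionFunction_pos [Nonempty ι] (h : Summable fun i => Real.exp (-E i / kT)) :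
    0 < ∑' i, Real.exp (-E i / kT) :=
  h.tsum_pos (fun _ => (Real.exp_pos _).le) (Classical.arbitrary ι) (Real.exp_pos _)

theorem gibbsWeight_nonneg (kT : ℝ) (E : ι → ℝ) (i : ι) : 0 ≤ gibbsWeight kT E i :=
  div_nonneg (Real.exp_pos _).le (tsum_nonneg fun _ => (Real.exp_pos _).le)

theorem gibbsWeight_pos [Nonempty ι] (h : Summable fun i => Real.exp (-E i / kT)) (i : ι) :
    0 < gibbsWeight kT E i :=
  div_pos (Real.exp_pos _) (partitionFunction_pos h)

theorem hasSum_gibbsWeight [Nonempty ι] (h : Summable fun i => Real.exp (-E i / kT)) :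
    HasSum (gibbsWeight kT E) 1 := by
  have := h.hasSum.div_const (∑' i, Real.exp (-E i / kT))
  rwa [div_self (partitionFunction_pos h).ne'] at this

theorem summable_exp_prod {F : κ → ℝ} (hE : Summable fun i => Real.exp (-E i / kT))
    (hF : Summable fun j => Real.exp (-F j / kT)) :
    Summable fun p : ι × κ => Real.exp (-(E p.1 + F p.2) / kT) := by
  refine (hE.mul_of_nonneg hF (fun _ => (Real.exp_pos _).le)
    (fun _ => (Real.exp_pos _).le)).congr fun p => ?_
  rw [← Real.exp_add]
  ring_nf

/-- The Gibbs state of two uncoupled systems is the product of their Gibbs states. -/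
theorem gibbsWeight_prod {F : κ → ℝ} (hE : Summable fun i => Real.exp (-E i / kT))
    (hF : Summable fun j => Real.exp (-F j / kT)) (p : ι × κ) :
    gibbsWeight kT (fun p : ι × κ => E p.1 + F p.2) p =
      gibbsWeight kT E p.1 * gibbsWeight kT F p.2 := by
  have key : ∀ p : ι × κ, Real.exp (-(E p.1 + F p.2) / kT) =
      Real.exp (-E p.1 / kT) * Real.exp (-F p.2 / kT) := fun p => by
    rw [← Real.exp_add]
    ring_nf
  have hs := summable_exp_prod hE hF
  simp only [gibbsWeight]
  simp only [key] at hs ⊢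
  rw [← hE.tsum_mul_tsum hF hs]
  ring

/-- States of equal total energy carry equal Gibbs weight. -/
theorem gibbsWeight_mul_eq_of_energy_eq {F : κ → ℝ} {i i' : ι} {j j' : κ}
    (h : E i + F j = E i' + F j') :
    gibbsWeight kT E i * gibbsWeight kT F j = gibbsWeight kT E i' * gibbsWeight kT F j' := by
  simp only [gibbsWeight, div_mul_div_comm, ← Real.exp_add]
  rw [show -E i / kT + -F j / kT = -E i' / kT + -F j' / kT by
    rw [← add_div, ← add_div]
    congr 1
    linarith]

theorem gibbsWeight_const [Fintype ι] (kT c : ℝ) (i : ι) :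
    gibbsWeight kT (fun _ : ι => c) i = (Fintype.card ι : ℝ)⁻¹ := by
  have : Real.exp (-c / kT) ≠ 0 := (Real.exp_pos _).ne'
  simp only [gibbsWeight, tsum_fintype, Finset.sum_const, Finset.card_univ, nsmul_eq_mul]
  field_simp

end Gibbs

section FiniteSystem

theorem basisState_eq_diagonal {α : Type} [DecidableEq α] (i : α) :
    basisState i = Matrix.diagonal fun j => (((if j = i then 1 else 0 : ℝ)) : ℂ) := by
  ext a b
  by_cases hab : a = b
  · subst hab
    rcases eq_or_ne i a with rfl | hia
    · simp [basisState]
    · simp [basisState, hia, hia.symm]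
  · simp only [basisState, Matrix.single_apply, Matrix.diagonal_apply, if_neg hab]
    exact if_neg fun h => hab (h.1.symm.trans h.2)

variable {α : Type} [Fintype α] {kT : ℝ} {E : α → ℝ}

theorem gibbsWeight_pos' [Nonempty α] (kT : ℝ) (E : α → ℝ) (i : α) : 0 < gibbsWeight kT E i :=
  gibbsWeight_pos .of_finite i

theorem sum_gibbsWeight [Nonempty α] (kT : ℝ) (E : α → ℝ) : ∑ i, gibbsWeight kT E i = 1 := by
  have := (hasSum_gibbsWeight (kT := kT) (E := E) .of_finite).tsum_eq
  rwa [tsum_fintype] at this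

theorem gibbsWeight_withBattery (kT : ℝ) (E : α → ℝ) (n : ℕ) (p : α × Qubits n) :
    gibbsWeight kT (withBattery E n) p = gibbsWeight kT E p.1 / 2 ^ n := by
  have h := gibbsWeight_prod (kT := kT) (E := E) (F := fun _ : Qubits n => (0 : ℝ))
    .of_finite .of_finite p
  simp only [add_zero] at h
  rw [show withBattery E n = fun p => E p.1 from rfl, h, gibbsWeight_const]
  simp [div_eq_mul_inv]

variable [DecidableEq α]

theorem entropy_diagonal (p : α → ℝ) :
    entropy (Matrix.diagonal fun i => (p i : ℂ)) = ∑ i, Real.negMulLog (p i) := by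
  have hA : (Matrix.diagonal fun i => (p i : ℂ)).IsHermitian :=
    Matrix.isHermitian_diagonal_of_self_adjoint _ (by ext i; simp)
  have hm : Finset.univ.val.map hA.eigenvalues = Finset.univ.val.map p := by
    have h := hA.roots_charpoly_eq_eigenvalues
    rw [Matrix.charpoly_diagonal, Polynomial.roots_prod _ _
      (Finset.prod_ne_zero_iff.2 fun i _ => Polynomial.X_sub_C_ne_zero _)] at h
    simp only [Polynomial.roots_X_sub_C, Multiset.bind_singleton] at h
    have := congrArg (Multiset.map Complex.re) h
    simpa [Multiset.map_map, Function.comp_def] using this.symm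
  rw [entropy, hA.cfc_eq, Matrix.IsHermitian.cfc, Unitary.conjStarAlgAut_apply,
    Matrix.trace_mul_cycle, Unitary.star_mul_self_of_mem (SetLike.coe_mem _), one_mul]
  have := congrArg (fun s => (s.map Real.negMulLog).sum) hm
  simp only [Multiset.map_map] at this
  rw [Matrix.trace_diagonal, Complex.re_sum]
  exact this

theorem freeEnergy_diagonal (p : α → ℝ) :
    freeEnergy kT E (Matrix.diagonal fun i => (p i : ℂ)) =
      ∑ i, (E i * p i - kT * Real.negMulLog (p i)) := by
  rw [freeEnergy, entropy_diagonal, hamiltonian, Matrix.diagonal_mul_diagonal,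
    Matrix.trace_diagonal, Finset.sum_sub_distrib, Finset.mul_sum]
  simp

/-- The free energy of the Gibbs state is `-kT ln Z`, that of `|i⟩⟨i|` is `E i`, and the difference
is `kT` times the surprisal of `i` in the Gibbs state. -/
theorem freeEnergyGap_eq [Nonempty α] (hkT : 0 < kT) (i : α) :
    freeEnergyGap kT E i = -kT * Real.log (gibbsWeight kT E i) := by
  set Z : ℝ := ∑' j, Real.exp (-E j / kT) with hZ
  have hZpos : 0 < Z := partitionFunction_pos .of_finite
  have hlog : ∀ j, Real.log (gibbsWeight kT E j) = -E j / kT - Real.log Z := fun j => by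
    rw [gibbsWeight, Real.log_div (Real.exp_pos _).ne' hZpos.ne', Real.log_exp]
  have h1 : freeEnergy kT E (basisState i) = E i := by
    rw [basisState_eq_diagonal, freeEnergy_diagonal, Finset.sum_eq_single i] <;>
      simp +contextual
  have h2 : freeEnergy kT E (gibbsState kT E) = -kT * Real.log Z := by
    rw [gibbsState, freeEnergy_diagonal]
    have : ∀ j, E j * gibbsWeight kT E j - kT * Real.negMulLog (gibbsWeight kT E j) =
        (-kT * Real.log Z) * gibbsWeight kT E j := fun j => by
      rw [Real.negMulLog, hlog]
      field_simp
      ring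
    rw [Finset.sum_congr rfl fun j _ => this j, ← Finset.mul_sum, sum_gibbsWeight, mul_one]
  rw [freeEnergyGap, h1, h2, hlog]
  field_simp
  ring

end FiniteSystem

/-! ### Thermal operations are Gibbs preserving -/

section Positivity

variable {α β : Type} [Fintype α] [Fintype β]

theorem IsCompletelyPositive.posSemidef {Φ : Matrix α α ℂ →ₗ[ℂ] Matrix β β ℂ}
    (h : IsCompletelyPositive Φ) {R : Matrix α α ℂ} (hR : R.PosSemidef) : (Φ R).PosSemidef :=
  (h 1 (R.submatrix Prod.snd Prod.snd) (hR.submatrix _)).submatrix fun b => ((0 : Fin 1), b)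

theorem posSemidef_of_hasSum {ι : Type} {f : ι → Matrix β β ℂ} {R : Matrix β β ℂ}
    (hf : ∀ i, (f i).PosSemidef) (h : HasSum f R) : R.PosSemidef := by
  refine Matrix.PosSemidef.of_dotProduct_mulVec_nonneg ?_ fun x => ?_
  · have h' := h.matrix_conjTranspose
    simp only [fun i => (hf i).isHermitian.eq] at h'
    exact h'.unique h
  · have hc : Continuous fun A : Matrix β β ℂ => star x ⬝ᵥ (A *ᵥ x) := by fun_prop
    have hs := h.map ({ toFun := fun A => star x ⬝ᵥ (A *ᵥ x)
                        map_zero' := by simp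
                        map_add' := fun A B => by
                          rw [Matrix.add_mulVec, dotProduct_add] } : Matrix β β ℂ →+ ℂ) hc
    exact hs.nonneg fun i => (hf i).dotProduct_mulVec_nonneg x

/-- A map with a (possibly infinite) Kraus decomposition is completely positive. -/
theorem isCompletelyPositive_of_hasSum {ι : Type} {Φ : Matrix α α ℂ →ₗ[ℂ] Matrix β β ℂ}
    {w : ι → ℝ} (hw : ∀ i, 0 ≤ w i) {B : ι → Matrix β α ℂ}
    (h : ∀ ρ, HasSum (fun i => (w i : ℂ) • (B i * ρ * (B i)ᴴ)) (Φ ρ)) :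
    IsCompletelyPositive Φ := by
  intro k R hR
  refine posSemidef_of_hasSum (f := fun i => (w i : ℂ) •
    (Matrix.kroneckerMap (· * ·) (1 : Matrix (Fin k) (Fin k) ℂ) (B i) * R *
      (Matrix.kroneckerMap (· * ·) (1 : Matrix (Fin k) (Fin k) ℂ) (B i))ᴴ))
    (fun i => (hR.mul_mul_conjTranspose_same _).smul (by exact_mod_cast hw i)) ?_
  refine Pi.hasSum.2 fun p => Pi.hasSum.2 fun q => ?_
  have h1 := Pi.hasSum.1 (Pi.hasSum.1 (h (Matrix.of fun a b => R (p.1, a) (q.1, b))) p.2) q.2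
  refine HasSum.congr_fun h1 fun i => ?_
  simp only [Matrix.smul_apply, Matrix.mul_apply, Matrix.of_apply, Matrix.conjTranspose_apply,
    Matrix.kroneckerMap_apply, Fintype.sum_prod_type, Matrix.one_apply, ite_mul, one_mul, zero_mul,
    apply_ite star, star_zero, mul_ite, mul_zero]
  simp [Finset.sum_ite_irrel]

theorem isChannel_trace_smul {σ : Matrix β β ℂ} (hσ : σ.PosSemidef) (htr : σ.trace = 1) :
    IsChannel ((Matrix.traceLinearMap α ℂ ℂ).smulRight σ) := by
  classical
  refine ⟨fun k R hR => ?_, fun ρ => by simp [htr]⟩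
  have h : (∑ a : α, R.submatrix (fun i : Fin k => (i, a)) fun i => (i, a)).PosSemidef :=
    Matrix.posSemidef_sum _ fun a _ => hR.submatrix _
  have e : (Matrix.of fun p q : Fin k × β =>
      (Matrix.traceLinearMap α ℂ ℂ).smulRight σ
        (Matrix.of fun a b => R (p.1, a) (q.1, b)) p.2 q.2) =
      Matrix.kroneckerMap (· * ·)
        (∑ a : α, R.submatrix (fun i : Fin k => (i, a)) fun i => (i, a)) σ := by
    ext p q
    simp [Matrix.trace, Matrix.sum_apply]
  rw [e]
  exact h.kronecker hσ

end Positivity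

variable {α : Type} [Fintype α] [DecidableEq α] {kT : ℝ} {E : α → ℝ}

/-- Thermal operations are free operations in the sense of Gibbs preservation: the operators
`√γ_f ⟨e|U|f⟩` form a Kraus decomposition, the columns of `U` give trace preservation, and energy
conservation moves the Gibbs weights of system and bath from one side of `U` to the other, whence
the rows of `U` show that the Gibbs state is fixed. -/
theorem IsThermalOperation.isGibbsPreserving [Nonempty α]
    {Φ : Matrix α α ℂ →ₗ[ℂ] Matrix α α ℂ}
    (h : IsThermalOperation kT E Φ) : IsGibbsPreserving kT E Φ := by
  obtain ⟨ι, ω, U, hne, hsum, henergy, hrow, hrow', hcol, hcol', hΦ⟩ := h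
  classical
  have hγ := hasSum_gibbsWeight (kT := kT) (E := ω) hsum
  have hγC : HasSum (fun f => (gibbsWeight kT ω f : ℂ)) 1 := by
    simpa using Complex.hasSum_ofReal.2 hγ
  -- sums over the product `α × ι` in the rows and columns, as sums over `ι` of finite sums
  have fiber : ∀ {g : α × ι → ℂ} {z : ℂ}, HasSum g z → HasSum (fun e => ∑ a, g (a, e)) z :=
    fun {g z} hg => ((Equiv.prodComm ι α).hasSum_iff.2 hg).prod_fiberwise
      fun e => hasSum_fintype fun a => g (a, e)
  have hrow2 : ∀ p q, HasSum (fun r => U p r * star (U q r)) (if p = q then 1 else 0) :=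
    fun p q => by
      split_ifs with hpq
      · exact hpq ▸ hrow p
      · exact hrow' p q hpq
  have hcol2 : ∀ p q, HasSum (fun r => star (U r p) * U r q) (if p = q then 1 else 0) :=
    fun p q => by
      split_ifs with hpq
      · exact hpq ▸ hcol p
      · exact hcol' p q hpq
  refine ⟨⟨isCompletelyPositive_of_hasSum (fun p : ι × ι => gibbsWeight_nonneg kT ω p.2) hΦ,
    fun ρ => ?_⟩, ?_⟩
  · -- trace preservation
    have h1 : HasSum (fun p : ι × ι => (gibbsWeight kT ω p.1 : ℂ) *
        (bathBlock U p.2 p.1 * ρ * (bathBlock U p.2 p.1)ᴴ).trace) (Φ ρ).trace := by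
      have := (hΦ ρ).map (Matrix.traceAddMonoidHom α ℂ) (by
        show Continuous fun A : Matrix α α ℂ => A.trace
        fun_prop)
      refine HasSum.congr_fun ((Equiv.prodComm ι ι).hasSum_iff.2 this) fun p => ?_
      simp
    have h2 : ∀ f, HasSum (fun e => (gibbsWeight kT ω f : ℂ) *
        (bathBlock U e f * ρ * (bathBlock U e f)ᴴ).trace) (gibbsWeight kT ω f * ρ.trace) := by
      intro f
      refine HasSum.mul_left _ ?_
      have h3 : HasSum (fun e => ∑ c, ∑ b, ρ b c * ∑ a, star (U (a, e) (c, f)) * U (a, e) (b, f))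
          (∑ c, ∑ b, ρ b c * (if (c, f) = (b, f) then 1 else 0)) :=
        hasSum_sum fun c _ => hasSum_sum fun b _ =>
          (fiber (hcol2 (c, f) (b, f))).mul_left _
      have h4 : ∑ c, ∑ b, ρ b c * (if (c, f) = (b, f) then 1 else 0) = ρ.trace := by
        simp [Matrix.trace]
      rw [h4] at h3
      refine HasSum.congr_fun h3 fun e => ?_
      simp only [Matrix.trace, Matrix.diag_apply, Matrix.mul_apply, bathBlock, Matrix.of_apply,
        Matrix.conjTranspose_apply, Finset.sum_mul, Finset.mul_sum]
      rw [Finset.sum_comm]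
      refine Finset.sum_congr rfl fun c _ => ?_
      rw [Finset.sum_comm]
      refine Finset.sum_congr rfl fun b _ => Finset.sum_congr rfl fun a _ => ?_
      ring
    have h5 := h1.prod_fiberwise h2
    exact h5.unique (by simpa using hγC.mul_right ρ.trace)
  · -- the Gibbs state is a fixed point
    ext a b
    have h1 := Pi.hasSum.1 (Pi.hasSum.1 (hΦ (gibbsState kT E)) a) b
    have h2 : ∀ e, HasSum (fun f => (((gibbsWeight kT ω f : ℂ) •
        (bathBlock U e f * gibbsState kT E * (bathBlock U e f)ᴴ)) a b))
        ((gibbsWeight kT ω e : ℂ) * gibbsState kT E a b) := by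
      intro e
      have h3 := (fiber (hrow2 (a, e) (b, e))).mul_left
        ((gibbsWeight kT E a * gibbsWeight kT ω e : ℝ) : ℂ)
      have h4 : ((gibbsWeight kT E a * gibbsWeight kT ω e : ℝ) : ℂ) *
          (if (a, e) = (b, e) then 1 else 0) = (gibbsWeight kT ω e : ℂ) * gibbsState kT E a b := by
        by_cases hab : a = b
        · subst hab
          simp [gibbsState, mul_comm]
        · simp [gibbsState, hab]
      rw [h4] at h3
      refine HasSum.congr_fun h3 fun f => ?_
      rw [Matrix.smul_apply, Matrix.mul_apply, gibbsState]
      simp only [bathBlock, Matrix.mul_diagonal, Matrix.of_apply, Matrix.conjTranspose_apply,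
        smul_eq_mul, Finset.mul_sum]
      refine Finset.sum_congr rfl fun c _ => ?_
      by_cases hU : U (a, e) (c, f) = 0
      · simp [hU]
      · have hE : E a + ω e = E c + ω f := by
          by_contra hne
          exact hU (henergy _ _ hne)
        rw [gibbsWeight_mul_eq_of_energy_eq hE]
        push_cast
        ring
    have h5 := h1.prod_fiberwise h2
    exact h5.unique (by simpa using hγC.mul_right (gibbsState kT E a b))

/-! ### The lower bound on the consumption of clean qubits -/

section LowerBound

variable {α : Type} [Fintype α] [DecidableEq α] {kT : ℝ} {E : α → ℝ}

theorem posSemidef_gibbsState {α : Type} [DecidableEq α] (kT : ℝ) (E : α → ℝ) :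
    (gibbsState kT E).PosSemidef :=
  Matrix.posSemidef_diagonal_iff.2 fun a => Complex.zero_le_real.2 (gibbsWeight_nonneg kT E a)

theorem trace_gibbsState [Nonempty α] (kT : ℝ) (E : α → ℝ) : (gibbsState kT E).trace = 1 := by
  rw [gibbsState, Matrix.trace_diagonal, ← Complex.ofReal_sum, sum_gibbsWeight, Complex.ofReal_one]

/-- The joint Gibbs state of system and battery dominates `(|S| / 2 ^ n) Γ ⊗ τ_S`. A Gibbs
preserving implementation of `M` maps this to the inequality `M Γ ≤ (|S'| / |S|) Γ`, of which only
the diagonal is needed. -/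
theorem Implements.apply_gibbsState_le {n : ℕ} {S S' : Finset (Qubits n)}
    {Φ : Matrix (α × Qubits n) (α × Qubits n) ℂ →ₗ[ℂ] Matrix (α × Qubits n) (α × Qubits n) ℂ}
    {M : Matrix α α ℂ →ₗ[ℂ] Matrix α α ℂ} (hS : S.Nonempty) (hS' : S'.Nonempty)
    (hΦ : IsGibbsPreserving kT (withBattery E n) Φ) (hM : Implements Φ S S' M) (a : α) :
    (M (gibbsState kT E) a a).re ≤ (S'.card / S.card : ℝ) * gibbsWeight kT E a := by
  have hs : (0 : ℝ) < S.card := by exact_mod_cast hS.card_pos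
  have hs' : (0 : ℝ) < S'.card := by exact_mod_cast hS'.card_pos
  set D : Matrix (α × Qubits n) (α × Qubits n) ℂ :=
    ((2 ^ n / S.card : ℝ) : ℂ) • gibbsState kT (withBattery E n) -
      Matrix.kroneckerMap (· * ·) (gibbsState kT E) (batteryState S) with hD
  have hDpos : D.PosSemidef := by
    have hD' : D = Matrix.diagonal fun p => (((if p.2 ∈ S then 0 else
        gibbsWeight kT E p.1 / S.card : ℝ)) : ℂ) := by
      ext p q
      by_cases hpq : p = q
      · subst hpq
        simp only [hD, gibbsState, batteryState, Matrix.sub_apply, Matrix.smul_apply,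
          Matrix.diagonal_apply_eq, Matrix.kroneckerMap_apply, gibbsWeight_withBattery, smul_eq_mul]
        split_ifs <;> push_cast <;> field_simp <;> simp
      · have : p.1 ≠ q.1 ∨ p.2 ≠ q.2 := by
          by_contra! h
          exact hpq (Prod.ext h.1 h.2)
        rcases this with h | h <;>
          simp [hD, gibbsState, batteryState, Matrix.diagonal_apply_ne _ hpq,
            Matrix.diagonal_apply_ne _ h]
    rw [hD', Matrix.posSemidef_diagonal_iff]
    intro p
    have := gibbsWeight_nonneg kT E p.1
    rw [Complex.zero_le_real]
    split_ifs <;> positivity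
  obtain ⟨x, hx⟩ := hS'
  have h := (hΦ.1.1.posSemidef hDpos).diag_nonneg (i := (a, x))
  rw [hD, map_sub, map_smul, hΦ.2, hM] at h
  have h' := (Complex.le_def.1 h).1
  simp only [gibbsState, batteryState, Matrix.sub_apply, Matrix.smul_apply, if_pos hx,
    Matrix.diagonal_apply_eq, Matrix.kroneckerMap_apply, gibbsWeight_withBattery, smul_eq_mul,
    Complex.zero_re, Complex.sub_re, ← Complex.ofReal_mul, Complex.ofReal_re] at h'
  rw [show ((S'.card : ℂ))⁻¹ = ((S'.card : ℝ)⁻¹ : ℝ) by simp, Complex.re_mul_ofReal] at h'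
  have e : 2 ^ n / (S.card : ℝ) * (gibbsWeight kT E a / 2 ^ n) =
      gibbsWeight kT E a / S.card := by
    field_simp
  rw [e, sub_nonneg, ← div_eq_mul_inv, div_le_iff₀ hs'] at h'
  rw [gibbsState]
  calc _ ≤ _ := h'
    _ = _ := by ring

theorem cleanQubits_sub {n : ℕ} {S S' : Finset (Qubits n)} (hS : S.Nonempty) (hS' : S'.Nonempty) :
    cleanQubits S - cleanQubits S' = Real.logb 2 (S'.card / S.card) := by
  have hs : (S.card : ℝ) ≠ 0 := by exact_mod_cast hS.card_pos.ne'
  have hs' : (S'.card : ℝ) ≠ 0 := by exact_mod_cast hS'.card_pos.ne'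
  rw [Real.logb_div hs' hs, cleanQubits, cleanQubits]
  ring

theorem logb_le_neqCost {M : Matrix α α ℂ →ₗ[ℂ] Matrix α α ℂ} {a : α} {F : ℝ} [Nonempty α]
    (hF : 0 < F) (h : F ≤ (M (gibbsState kT E) a a).re) :
    ((Real.logb 2 (F / gibbsWeight kT E a) : ℝ) : EReal) ≤ neqCost kT E M := by
  refine le_sInf ?_
  rintro _ ⟨n, S, S', Φ, hS, hS', hΦ, hM, rfl⟩
  rw [EReal.coe_le_coe_iff, cleanQubits_sub hS hS']
  have hγ := gibbsWeight_pos' kT E a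
  exact Real.logb_le_logb_of_le one_lt_two (div_pos hF hγ)
    ((div_le_iff₀ hγ).2 (h.trans (hM.apply_gibbsState_le hS hS' hΦ a)))

theorem neqCost_nonneg [Nonempty α] {M : Matrix α α ℂ →ₗ[ℂ] Matrix α α ℂ} (hM : IsChannel M) :
    0 ≤ neqCost kT E M := by
  refine le_sInf ?_
  rintro _ ⟨n, S, S', Φ, hS, hS', hΦ, himp, rfl⟩
  rw [← EReal.coe_zero, EReal.coe_le_coe_iff, cleanQubits_sub hS hS']
  refine Real.logb_nonneg one_lt_two ?_
  have h1 : ∑ a, (M (gibbsState kT E) a a).re = 1 := by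
    have h := congrArg Complex.re (hM.2 (gibbsState kT E))
    rw [trace_gibbsState] at h
    simpa [Matrix.trace] using h
  calc (1 : ℝ) = ∑ a, (M (gibbsState kT E) a a).re := h1.symm
    _ ≤ ∑ a, (S'.card / S.card : ℝ) * gibbsWeight kT E a :=
      Finset.sum_le_sum fun a _ => himp.apply_gibbsState_le hS hS' hΦ a
    _ = S'.card / S.card := by rw [← Finset.mul_sum, sum_gibbsWeight, mul_one]

/-- Thermal implementations are Gibbs preserving implementations. -/
theorem neqCost_le_of_implements [Nonempty α] {n : ℕ} {S S' : Finset (Qubits n)}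
    {Φ : Matrix (α × Qubits n) (α × Qubits n) ℂ →ₗ[ℂ] Matrix (α × Qubits n) (α × Qubits n) ℂ}
    {M : Matrix α α ℂ →ₗ[ℂ] Matrix α α ℂ} (hS : S.Nonempty) (hS' : S'.Nonempty)
    (hΦ : IsThermalOperation kT (withBattery E n) Φ) (hM : Implements Φ S S' M) :
    neqCost kT E M ≤ ((cleanQubits S - cleanQubits S' : ℝ) : EReal) :=
  sInf_le ⟨n, S, S', Φ, hS, hS', hΦ.isGibbsPreserving, hM, rfl⟩

theorem logb_le_workCost [Nonempty α] (hkT : 0 < kT) {M : Matrix α α ℂ →ₗ[ℂ] Matrix α α ℂ}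
    {c : ℝ} (h : (c : EReal) ≤ neqCost kT E M) :
    ((kT * Real.log 2 * c : ℝ) : EReal) ≤ workCost kT E M := by
  refine le_sInf ?_
  rintro _ ⟨n, S, S', Φ, hS, hS', hΦ, hM, rfl⟩
  rw [EReal.coe_le_coe_iff]
  have h1 := EReal.coe_le_coe_iff.1 (h.trans (neqCost_le_of_implements hS hS' hΦ hM))
  have := Real.log_pos one_lt_two
  gcongr

end LowerBound

/-! ### Accuracy of erasure -/

section Accuracy

variable {α : Type} [Fintype α] [DecidableEq α] {kT : ℝ} {E : α → ℝ} {i : α}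

theorem trace_basisState (i : α) : (basisState i).trace = 1 := by
  rw [basisState, Matrix.trace_single_eq_same]

theorem trace_basisState_mul (i : α) (R : Matrix α α ℂ) : (basisState i * R).trace = R i i := by
  simp [basisState, Matrix.trace_single_mul]

instance [Nonempty α] (i : α) : Nonempty (erasure i).X :=
  ⟨⟨EuclideanSpace.single i 1, by simp⟩⟩

theorem posSemidef_erasure_input (i : α) (ψ : (erasure i).X) :
    ((erasure i).input ψ).PosSemidef :=
  Matrix.posSemidef_vecMulVec_self_star fun a => ψ.1 a

theorem trace_erasure_input (i : α) (ψ : (erasure i).X) : ((erasure i).input ψ).trace = 1 := by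
  have h := EuclideanSpace.norm_sq_eq ψ.1
  rw [ψ.2, one_pow] at h
  simp only [erasure, Matrix.trace_vecMulVec, dotProduct, Complex.star_def, Complex.mul_conj]
  rw [← Complex.ofReal_sum]
  simp only [Complex.normSq_eq_norm_sq]
  exact_mod_cast h.symm

theorem erasure_accuracy (i : α) (M : Matrix α α ℂ →ₗ[ℂ] Matrix α α ℂ) :
    (erasure i).accuracy M = ⨅ ψ, (M ((erasure i).input ψ) i i).re :=
  iInf_congr fun _ => congrArg Complex.re (trace_basisState_mul i _)

theorem erasure_accuracy_le {M : Matrix α α ℂ →ₗ[ℂ] Matrix α α ℂ} (hM : IsChannel M)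
    (ψ : (erasure i).X) : (erasure i).accuracy M ≤ (M ((erasure i).input ψ) i i).re := by
  rw [erasure_accuracy]
  refine ciInf_le ⟨0, ?_⟩ ψ
  rintro _ ⟨φ, rfl⟩
  exact (Complex.le_def.1 (hM.1.posSemidef (posSemidef_erasure_input i φ)).diag_nonneg).1

theorem erasure_accuracy_le_one {M : Matrix α α ℂ →ₗ[ℂ] Matrix α α ℂ} (hM : IsChannel M) :
    (erasure i).accuracy M ≤ 1 := by
  let ψ : (erasure i).X := ⟨EuclideanSpace.single i 1, by simp⟩
  refine (erasure_accuracy_le hM ψ).trans ?_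
  have h1 := congrArg Complex.re ((hM.2 _).trans (trace_erasure_input i ψ))
  rw [Matrix.trace, Complex.re_sum, Complex.one_re] at h1
  rw [← h1]
  exact Finset.single_le_sum (f := fun a => (M ((erasure i).input ψ) a a).re) (fun a _ =>
    (Complex.le_def.1 (hM.1.posSemidef (posSemidef_erasure_input i ψ)).diag_nonneg).1)
    (Finset.mem_univ i)

/-- The Gibbs state is a mixture of pure states, so it is erased at least as accurately as the
worst pure state. -/
theorem erasure_accuracy_le_apply_gibbsState [Nonempty α]
    {M : Matrix α α ℂ →ₗ[ℂ] Matrix α α ℂ} (hM : IsChannel M) :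
    (erasure i).accuracy M ≤ (M (gibbsState kT E) i i).re := by
  let ψ : α → (erasure i).X := fun b => ⟨EuclideanSpace.single b 1, by simp⟩
  have h1 : gibbsState kT E = ∑ b, (gibbsWeight kT E b : ℂ) • (erasure i).input (ψ b) := by
    ext c e
    simp only [gibbsState, erasure, ψ, Matrix.sum_apply, Matrix.smul_apply, Matrix.vecMulVec_apply,
      Matrix.diagonal_apply, PiLp.single_apply]
    by_cases hce : c = e
    · subst hce
      simp
    · rw [if_neg hce, eq_comm]
      refine Finset.sum_eq_zero fun b _ => ?_
      by_cases hcb : c = b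
      · simp [← hcb, Ne.symm hce]
      · simp [hcb]
  have h2 : (M (gibbsState kT E) i i).re =
      ∑ b, gibbsWeight kT E b * (M ((erasure i).input (ψ b)) i i).re := by
    rw [h1, map_sum, Matrix.sum_apply, Complex.re_sum]
    simp
  rw [h2, ← one_mul ((erasure i).accuracy M), ← sum_gibbsWeight kT E, Finset.sum_mul]
  exact Finset.sum_le_sum fun b _ =>
    mul_le_mul_of_nonneg_left (erasure_accuracy_le hM (ψ b)) (gibbsWeight_nonneg kT E b)

theorem erasure_accuracy_trace_smul (σ : Matrix α α ℂ) :
    (erasure i).accuracy ((Matrix.traceLinearMap α ℂ ℂ).smulRight σ) = (σ i i).re := by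
  have : Nonempty α := ⟨i⟩
  rw [erasure_accuracy]
  simp [trace_erasure_input]

/-- The reverse entropy of erasure is the surprisal of the target state in the Gibbs state. In the
reversed task every input is proportional to `|i⟩⟨i|`, and the accuracy of an output `σ` is
`Γ_i` times the smallest eigenvalue of `Γ^(-1/2) σ Γ^(-1/2)`, which is at most `1`, with equality
for `σ = Γ`. -/
theorem reverseEntropy_erasure [Nonempty α] (kT : ℝ) (E : α → ℝ) (i : α) :
    (erasure i).reverseEntropy kT E = -Real.logb 2 (gibbsWeight kT E i) := by
  have hγ := gibbsWeight_pos' kT E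
  have hin : gibbsSqrt kT E * basisState i * gibbsSqrt kT E =
      (gibbsWeight kT E i : ℂ) • basisState i := by
    ext a b
    rw [gibbsSqrt, Matrix.mul_diagonal, Matrix.diagonal_mul, basisState, Matrix.smul_apply,
      Matrix.single_apply]
    split_ifs with h
    · obtain ⟨rfl, rfl⟩ := h
      rw [mul_one, smul_eq_mul, mul_one, ← Complex.ofReal_mul, Real.mul_self_sqrt (hγ i).le]
    · simp
  have hval : ∀ (M : Matrix α α ℂ →ₗ[ℂ] Matrix α α ℂ) (ψ : (erasure i).X),
      ((((erasure i).reverse kT E).observable ψ *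
        M (((erasure i).reverse kT E).input ψ)).trace).re =
      gibbsWeight kT E i * ((gibbsInvSqrt kT E * (erasure i).input ψ * gibbsInvSqrt kT E) *
        M (basisState i)).trace.re := fun M ψ => by
    have : ((erasure i).reverse kT E).input ψ = (gibbsWeight kT E i : ℂ) • basisState i := hin
    rw [this, map_smul, Matrix.mul_smul, Matrix.trace_smul, smul_eq_mul, Complex.re_ofReal_mul]
    rfl
  have hmax : IsGreatest {f | ∃ M : Matrix α α ℂ →ₗ[ℂ] Matrix α α ℂ,
      IsChannel M ∧ f = ((erasure i).reverse kT E).accuracy M} (gibbsWeight kT E i) := by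
    refine ⟨⟨(Matrix.traceLinearMap α ℂ ℂ).smulRight (gibbsState kT E),
      isChannel_trace_smul ?_ ?_, ?_⟩, ?_⟩
    · exact posSemidef_gibbsState kT E
    · exact trace_gibbsState kT E
    · have hψ : ∀ ψ : (erasure i).X, gibbsWeight kT E i *
          ((gibbsInvSqrt kT E * (erasure i).input ψ * gibbsInvSqrt kT E) *
            (Matrix.traceLinearMap α ℂ ℂ).smulRight (gibbsState kT E) (basisState i)).trace.re =
          gibbsWeight kT E i := fun ψ => by
        have h1 : gibbsInvSqrt kT E * gibbsState kT E * gibbsInvSqrt kT E = 1 := by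
          rw [gibbsInvSqrt, gibbsState, Matrix.diagonal_mul_diagonal,
            Matrix.diagonal_mul_diagonal, ← Matrix.diagonal_one]
          congr 1
          ext a
          have := Real.sq_sqrt (hγ a).le
          have h0 := (Real.sqrt_pos.2 (hγ a)).ne'
          rw [← Complex.ofReal_mul, ← Complex.ofReal_mul, ← Complex.ofReal_one]
          congr 1
          field_simp
          exact this.symm
        rw [LinearMap.smulRight_apply, Matrix.traceLinearMap_apply, trace_basisState, one_smul,
          Matrix.mul_assoc, Matrix.mul_assoc, Matrix.trace_mul_comm, Matrix.mul_assoc,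
          h1, Matrix.mul_one, trace_erasure_input, Complex.one_re, mul_one]
      exact (ciInf_const (ι := (erasure i).X)).symm.trans
        (iInf_congr fun ψ => ((hval _ ψ).trans (hψ ψ)).symm)
    · rintro _ ⟨M, hM, rfl⟩
      have hσ : (M (basisState i)).PosSemidef := hM.1.posSemidef (by
        rw [basisState_eq_diagonal, Matrix.posSemidef_diagonal_iff]
        intro j
        split_ifs <;> simp)
      have htr : ∑ b, (M (basisState i) b b).re = 1 := by
        have h := congrArg Complex.re (hM.2 (basisState i))
        rw [trace_basisState] at h
        simpa only [Matrix.trace, Matrix.diag_apply, Complex.re_sum, Complex.one_re] using h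
      have hle : ∀ ψ : (erasure i).X, ((erasure i).reverse kT E).accuracy M ≤
          gibbsWeight kT E i * ((gibbsInvSqrt kT E * (erasure i).input ψ * gibbsInvSqrt kT E) *
            M (basisState i)).trace.re := fun ψ => by
        rw [← hval M ψ]
        refine ciInf_le ⟨0, ?_⟩ ψ
        rintro _ ⟨φ, rfl⟩
        have hφ := hval M φ
        beta_reduce
        rw [hφ]
        refine mul_nonneg (hγ i).le ?_
        have hG : (gibbsInvSqrt kT E)ᴴ = gibbsInvSqrt kT E := by
          rw [gibbsInvSqrt, Matrix.diagonal_conjTranspose]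
          congr 1
          ext a
          simp
        have hX := hσ.mul_mul_conjTranspose_same (gibbsInvSqrt kT E)
        rw [hG] at hX
        rw [Matrix.mul_assoc, Matrix.mul_assoc, Matrix.trace_mul_comm, Matrix.mul_assoc,
          show (erasure i).input φ = Matrix.vecMulVec (fun a => φ.1 a) (star fun a => φ.1 a)
          from rfl, Matrix.vecMulVec_mul, Matrix.trace_vecMulVec, dotProduct_comm,
          ← Matrix.dotProduct_mulVec]
        exact (Complex.le_def.1 (hX.dotProduct_mulVec_nonneg _)).1
      have hb : ∀ b, gibbsWeight kT E b * ((erasure i).reverse kT E).accuracy M ≤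
          gibbsWeight kT E i * (M (basisState i) b b).re := fun b => by
        let ψ : (erasure i).X := ⟨EuclideanSpace.single b 1, by simp⟩
        have hin : (erasure i).input ψ = basisState b := by
          ext c e
          simp only [erasure, ψ, Matrix.vecMulVec_apply, PiLp.single_apply, basisState,
            Matrix.single_apply, @eq_comm _ b]
          by_cases hc : c = b <;> by_cases he : e = b <;> simp [hc, he]
        have hout : (gibbsInvSqrt kT E * (erasure i).input ψ * gibbsInvSqrt kT E) =
            (((gibbsWeight kT E b)⁻¹ : ℝ) : ℂ) • basisState b := by
          rw [hin]
          ext c e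
          rw [gibbsInvSqrt, Matrix.mul_diagonal, Matrix.diagonal_mul, basisState,
            Matrix.smul_apply, Matrix.single_apply]
          split_ifs with h
          · obtain ⟨rfl, rfl⟩ := h
            rw [mul_one, smul_eq_mul, mul_one, ← Complex.ofReal_mul, ← mul_inv,
              Real.mul_self_sqrt (hγ b).le]
          · simp
        have h := hle ψ
        rw [hout, Matrix.smul_mul, Matrix.trace_smul, trace_basisState_mul, smul_eq_mul,
          Complex.re_ofReal_mul] at h
        have hb0 := hγ b
        calc gibbsWeight kT E b * ((erasure i).reverse kT E).accuracy M
            ≤ gibbsWeight kT E b * (gibbsWeight kT E i *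
              ((gibbsWeight kT E b)⁻¹ * (M (basisState i) b b).re)) := by gcongr
          _ = gibbsWeight kT E i * (M (basisState i) b b).re := by field_simp
      have := Finset.sum_le_sum fun b (_ : b ∈ Finset.univ) => hb b
      rwa [← Finset.sum_mul, ← Finset.mul_sum, sum_gibbsWeight, htr, one_mul, mul_one] at this
  rw [Task.reverseEntropy, hmax.csSup_eq]

end Accuracy

/-! ### Thermal operations from energy-preserving permutations -/

section Permutation

variable {A ι : Type} [Fintype A] [DecidableEq A]

open Classical in
/-- The weight with which the operator `|c⟩⟨c'|` contributes `|p⟩⟨q|` to the reduced state when the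
basis states of system and bath are permuted by `π`: the probability of the bath states `f` for
which `π` takes `(c, f)` and `(c', f)` to `(p, e)` and `(q, e)` with a common bath state `e`. -/
def permCoeff (kT : ℝ) (ω : ι → ℝ) (π : Equiv.Perm (A × ι)) (p q c c' : A) : ℝ :=
  ∑' f, if (π (c, f)).1 = p ∧ (π (c', f)).1 = q ∧ (π (c, f)).2 = (π (c', f)).2
    then gibbsWeight kT ω f else 0

/-- The operation on the system induced by a permutation of the basis states of system and bath,
the bath being in its Gibbs state. -/
def permutationChannel (kT : ℝ) (ω : ι → ℝ) (π : Equiv.Perm (A × ι)) :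
    Matrix A A ℂ →ₗ[ℂ] Matrix A A ℂ where
  toFun ρ := Matrix.of fun p q => ∑ c, ∑ c', ρ c c' * (permCoeff kT ω π p q c c' : ℂ)
  map_add' ρ ρ' := by
    ext p q
    simp [add_mul, Finset.sum_add_distrib]
  map_smul' z ρ := by
    ext p q
    simp [mul_assoc, Finset.mul_sum]

theorem isThermalOperation_permutationChannel [Nonempty ι] {kT : ℝ} {E : A → ℝ} {ω : ι → ℝ}
    (hω : Summable fun e => Real.exp (-ω e / kT)) (π : Equiv.Perm (A × ι))
    (hπ : ∀ z, E (π z).1 + ω (π z).2 = E z.1 + ω z.2) :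
    IsThermalOperation kT E (permutationChannel kT ω π) := by
  classical
  refine ⟨ι, ω, fun x y => if x = π y then 1 else 0, inferInstance, hω, ?_, ?_, ?_, ?_, ?_, ?_⟩
  · intro p q h
    refine if_neg fun hpq => h ?_
    rw [hpq, hπ]
  · intro p
    convert hasSum_ite_eq (π.symm p) (1 : ℂ) using 1
    funext r
    by_cases h : p = π r
    · simp [h]
    · simp [h, show r ≠ π.symm p from fun h' => h (by simp [h'])]
  · intro p q hpq
    refine (hasSum_zero : HasSum (fun _ : A × ι => (0 : ℂ)) 0).congr_fun fun r => ?_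
    by_cases h : p = π r
    · simp [show q ≠ π r from fun h' => hpq (h.trans h'.symm)]
    · simp [h]
  · intro p
    convert hasSum_ite_eq (π p) (1 : ℂ) using 1
    funext r
    by_cases h : r = π p <;> simp [h]
  · intro p q hpq
    refine (hasSum_zero : HasSum (fun _ : A × ι => (0 : ℂ)) 0).congr_fun fun r => ?_
    by_cases h : r = π p
    · simp [show r ≠ π q from fun h' => hpq (π.injective (h.symm.trans h'))]
    · simp [h]
  · intro ρ
    refine Pi.hasSum.2 fun p => Pi.hasSum.2 fun q => ?_
    have key : ∀ c c', HasSum (fun x : ι × ι => (gibbsWeight kT ω x.2 : ℂ) *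
        ((if (p, x.1) = π (c, x.2) then 1 else 0) * (if (q, x.1) = π (c', x.2) then 1 else 0)))
        (permCoeff kT ω π p q c c' : ℂ) := by
      intro c c'
      have hinj : Function.Injective fun f : ι => ((π (c, f)).2, f) :=
        fun f f' h => (Prod.ext_iff.1 h).2
      refine (hinj.hasSum_iff ?_).1 ?_
      · rintro ⟨e, f⟩ hef
        have : (p, e) ≠ π (c, f) := fun h => hef ⟨f, Prod.ext (Prod.ext_iff.1 h).2.symm rfl⟩
        simp [this]
      · have hs : Summable fun f => if (π (c, f)).1 = p ∧ (π (c', f)).1 = q ∧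
            (π (c, f)).2 = (π (c', f)).2 then gibbsWeight kT ω f else 0 := by
          refine (hasSum_gibbsWeight hω).summable.of_nonneg_of_le (fun f => ?_) fun f => ?_ <;>
            have := gibbsWeight_nonneg kT ω f <;> split_ifs <;> first | exact this | exact le_rfl
        refine (Complex.hasSum_ofReal.2 hs.hasSum).congr_fun fun f => ?_
        by_cases h : (π (c, f)).1 = p ∧ (π (c', f)).1 = q ∧ (π (c, f)).2 = (π (c', f)).2
        · obtain ⟨h1, h2, h3⟩ := h
          have e1 : (p, (π (c, f)).2) = π (c, f) := Prod.ext h1.symm rfl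
          have e2 : (q, (π (c, f)).2) = π (c', f) := Prod.ext h2.symm h3
          simp only [Function.comp_apply, e1, if_pos, ← h3, h1, h2, e2, and_self]
          simp
        · rw [if_neg h]
          have : ¬ ((p, (π (c, f)).2) = π (c, f) ∧ (q, (π (c, f)).2) = π (c', f)) :=
            fun ⟨h1, h2⟩ => h ⟨(congrArg Prod.fst h1).symm, (congrArg Prod.fst h2).symm,
              (Prod.ext_iff.1 h2).2⟩
          rw [not_and_or] at this
          rcases this with h | h <;> simp [h]
    have hsum : HasSum (fun x : ι × ι => ∑ c, ∑ c', ρ c c' * ((gibbsWeight kT ω x.2 : ℂ) *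
        ((if (p, x.1) = π (c, x.2) then 1 else 0) * (if (q, x.1) = π (c', x.2) then 1 else 0))))
        (permutationChannel kT ω π ρ p q) :=
      hasSum_sum fun c _ => hasSum_sum fun c' _ => (key c c').mul_left _
    refine hsum.congr_fun fun x => ?_
    simp only [bathBlock, Matrix.smul_apply, Matrix.mul_apply, Matrix.of_apply,
      Matrix.conjTranspose_apply, smul_eq_mul, Finset.mul_sum, Finset.sum_mul]
    rw [Finset.sum_comm]
    refine Finset.sum_congr rfl fun c _ => Finset.sum_congr rfl fun c' _ => ?_
    rw [apply_ite star, star_one, star_zero]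
    ring

end Permutation

/-! ### Resetting system and battery through the bath -/

section Reset

variable {α ι : Type} {n : ℕ}

/-- The exchange of the battery with a register whose states are those of `S'`, if the state of the
battery is one of them. -/
def exchange (S' : Finset (Qubits n)) : Equiv.Perm (Qubits n × S') :=
  Function.Involutive.toPerm (fun z => if h : z.1 ∈ S' then (z.2.1, ⟨z.1, h⟩) else z) fun z => by
    by_cases h : z.1 ∈ S' <;> simp [h]

theorem exchange_of_mem {S' : Finset (Qubits n)} {x : Qubits n} (k : S') (h : x ∈ S') :
    exchange S' (x, k) = (k.1, ⟨x, h⟩) :=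
  dif_pos h

/-- First exchange the system with a bath copy of it, then apply `τ` to system, battery and the
rest `ι` of the bath, then exchange the battery with a register with states in `S'`. -/
def resetPerm (τ : Equiv.Perm ((α × Qubits n) × ι)) (S' : Finset (Qubits n)) :
    Equiv.Perm ((α × Qubits n) × (α × ι × S')) where
  toFun z :=
    let t := τ ((z.2.1, z.1.2), z.2.2.1)
    let y := exchange S' (t.1.2, z.2.2.2)
    ((t.1.1, y.1), (z.1.1, t.2, y.2))
  invFun z :=
    let y := (exchange S').symm (z.1.2, z.2.2.2)
    let t := τ.symm ((z.1.1, y.1), z.2.2.1)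
    ((z.2.1, t.1.2), (t.1.1, t.2, y.2))
  left_inv z := by simp
  right_inv z := by simp

variable [Fintype α] [DecidableEq α] {kT : ℝ} {E : α → ℝ} {ω : ι → ℝ}

/-- The energy levels of the bath used by `resetPerm`. -/
def resetBath (E : α → ℝ) (ω : ι → ℝ) (S' : Finset (Qubits n)) (f : α × ι × S') : ℝ :=
  E f.1 + (ω f.2.1 + 0)

/-- Distribution of the system after `τ` has acted on the Gibbs state of the system, the battery
state `batteryState S` and the Gibbs state of the bath. -/
def outputWeight (kT : ℝ) (E : α → ℝ) (ω : ι → ℝ) (τ : Equiv.Perm ((α × Qubits n) × ι))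
    (S : Finset (Qubits n)) (a : α) : ℝ :=
  (S.card : ℝ)⁻¹ * ∑ x ∈ S, ∑ b, gibbsWeight kT E b *
    ∑' j, if (τ ((b, x), j)).1.1 = a then gibbsWeight kT ω j else 0

theorem permCoeff_resetPerm [Nonempty ι] (hω : Summable fun e => Real.exp (-ω e / kT))
    {τ : Equiv.Perm ((α × Qubits n) × ι)} {S' : Finset (Qubits n)} (hS' : S'.Nonempty)
    {x : Qubits n} (hx : ∀ b j, (τ ((b, x), j)).1.2 ∈ S') (p q : α × Qubits n) (a a' : α) :
    permCoeff kT (resetBath E ω S') (resetPerm τ S') p q (a, x) (a', x) =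
      if a = a' ∧ p = q ∧ p.2 ∈ S' then (S'.card : ℝ)⁻¹ * ∑ b, gibbsWeight kT E b *
        ∑' j, if (τ ((b, x), j)).1.1 = p.1 then gibbsWeight kT ω j else 0
      else 0 := by
  classical
  have happ : ∀ a b j k, resetPerm τ S' ((a, x), (b, j, k)) =
      (((τ ((b, x), j)).1.1, k.1), (a, (τ ((b, x), j)).2, ⟨(τ ((b, x), j)).1.2, hx b j⟩)) :=
    fun a b j k => by simp [resetPerm, exchange_of_mem k (hx b j)]
  have hS0 : Nonempty S' := hS'.to_subtype
  have hα : Nonempty α := ⟨a⟩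
  have hE0 : Summable fun b => Real.exp (-E b / kT) := .of_finite
  have hS1 : Summable fun _ : S' => Real.exp (-(0 : ℝ) / kT) := .of_finite
  have hω1 := summable_exp_prod (E := ω) (F := fun _ : S' => (0 : ℝ)) hω hS1
  have hbath := summable_exp_prod (F := fun r : ι × S' => ω r.1 + 0) hE0 hω1
  have hγ : ∀ f : α × ι × S', gibbsWeight kT (resetBath E ω S') f =
      gibbsWeight kT E f.1 * (gibbsWeight kT ω f.2.1 * (S'.card : ℝ)⁻¹) := fun f => by
    refine (gibbsWeight_prod (F := fun r : ι × S' => ω r.1 + 0) hE0 hω1 f).trans ?_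
    rw [gibbsWeight_prod (E := ω) (F := fun _ : S' => (0 : ℝ)) hω hS1, gibbsWeight_const,
      Fintype.card_coe]
  rw [permCoeff]
  by_cases haa : a = a' ∧ p = q
  · obtain ⟨rfl, rfl⟩ := haa
    have hsum : Summable fun f : α × ι × S' =>
        if (τ ((f.1, x), f.2.1)).1.1 = p.1 ∧ f.2.2.1 = p.2 then
          gibbsWeight kT (resetBath E ω S') f else 0 := by
      refine (hasSum_gibbsWeight (E := resetBath E ω S')
        hbath).summable.of_nonneg_of_le (fun f => ?_) fun f => ?_ <;>
          have := gibbsWeight_nonneg kT (resetBath E ω S') f <;>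
            split_ifs <;> first | exact this | exact le_rfl
    have hterm : ∀ f : α × ι × S', (if (resetPerm τ S' ((a, x), f)).1 = p ∧
        (resetPerm τ S' ((a, x), f)).1 = p ∧
        (resetPerm τ S' ((a, x), f)).2 = (resetPerm τ S' ((a, x), f)).2
        then gibbsWeight kT (resetBath E ω S') f else 0) =
        if (τ ((f.1, x), f.2.1)).1.1 = p.1 ∧ f.2.2.1 = p.2 then
          gibbsWeight kT (resetBath E ω S') f else 0 := fun f => by
      simp only [happ, Prod.ext_iff, and_self, and_true]
    refine (tsum_congr fun f => by convert hterm f).trans ?_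
    rw [hsum.tsum_prod, tsum_fintype]
    have hk : ∀ b, (∑' r : ι × S', if (τ ((b, x), r.1)).1.1 = p.1 ∧ r.2.1 = p.2 then
        gibbsWeight kT (resetBath E ω S') (b, r) else 0) =
        if p.2 ∈ S' then (S'.card : ℝ)⁻¹ * (gibbsWeight kT E b *
          ∑' j, if (τ ((b, x), j)).1.1 = p.1 then gibbsWeight kT ω j else 0) else 0 := by
      intro b
      have hsb := hsum.prod_factor b
      rw [hsb.tsum_prod]
      have hj : ∀ j, (∑' k : S', if (τ ((b, x), j)).1.1 = p.1 ∧ k.1 = p.2 then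
          gibbsWeight kT (resetBath E ω S') (b, j, k) else 0) = if p.2 ∈ S' then
          (S'.card : ℝ)⁻¹ * gibbsWeight kT E b *
            (if (τ ((b, x), j)).1.1 = p.1 then gibbsWeight kT ω j else 0) else 0 := by
        intro j
        simp only [tsum_fintype, hγ]
        split_ifs with hp ht
        · rw [Finset.sum_eq_single ⟨p.2, hp⟩]
          · simp only [ht, and_self, if_true]
            ring
          · intro k _ hk
            exact if_neg fun h => hk (Subtype.ext h.2)
          · simp
        · simp [ht]
        · exact Finset.sum_eq_zero fun k _ => if_neg fun h : _ ∧ k.1 = p.2 => hp (h.2 ▸ k.2)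
      simp only [hj]
      split_ifs
      · rw [tsum_mul_left, mul_assoc]
      · simp
    simp only [hk]
    split_ifs with h1 h2 h2
    · rw [Finset.mul_sum]
    · exact absurd ⟨trivial, trivial, h1⟩ h2
    · exact absurd h2.2.2 h1
    · simp
  · rw [if_neg fun h => haa ⟨h.1, h.2.1⟩]
    convert tsum_zero with f
    refine if_neg fun h => haa ?_
    obtain ⟨b, j, k⟩ := f
    simp only [happ, Prod.mk.injEq, and_true] at h
    exact ⟨h.2.2, h.1.symm.trans h.2.1⟩

/-- A permutation `τ` of the states of system, battery and bath that conserves energy and takes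
the battery from `S` to `S'` yields a thermal operation that replaces the state of the system by the
distribution `outputWeight`, and the battery state `batteryState S` by `batteryState S'`. -/
theorem exists_thermal_implements_trace_smul [Nonempty α] [Nonempty ι]
    (hω : Summable fun e => Real.exp (-ω e / kT)) (τ : Equiv.Perm ((α × Qubits n) × ι))
    (hτ : ∀ z, E (τ z).1.1 + ω (τ z).2 = E z.1.1 + ω z.2) {S S' : Finset (Qubits n)}
    (hS' : S'.Nonempty) (hSS' : ∀ b, ∀ x ∈ S, ∀ j, (τ ((b, x), j)).1.2 ∈ S') :
    ∃ Φ, IsThermalOperation kT (withBattery E n) Φ ∧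
      Implements Φ S S' ((Matrix.traceLinearMap α ℂ ℂ).smulRight
        (Matrix.diagonal fun a => (outputWeight kT E ω τ S a : ℂ))) := by
  have hS0 : Nonempty S' := hS'.to_subtype
  have hω1 := summable_exp_prod (E := ω) (F := fun _ : S' => (0 : ℝ)) hω
    (.of_finite (f := fun _ : S' => Real.exp (-(0 : ℝ) / kT)))
  have hbath := summable_exp_prod (E := E) (F := fun r : ι × S' => ω r.1 + 0) .of_finite hω1
  refine ⟨permutationChannel kT (resetBath E ω S') (resetPerm τ S'),
    isThermalOperation_permutationChannel hbath _ fun z => ?_, fun ρ => ?_⟩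
  · have := hτ ((z.2.1, z.1.2), z.2.2.1)
    simp only [resetPerm, withBattery, Equiv.coe_fn_mk, add_zero]
    linarith
  · ext p q
    have hL : permutationChannel kT (resetBath E ω S') (resetPerm τ S')
        (Matrix.kroneckerMap (· * ·) ρ (batteryState S)) p q =
        ∑ a, ∑ a', ∑ x ∈ S, ρ a a' * (S.card : ℂ)⁻¹ *
          (permCoeff kT (resetBath E ω S') (resetPerm τ S') p q (a, x) (a', x) : ℂ) := by
      have : ∀ (g : α → Qubits n → α → Qubits n → ℂ),
          ∑ a, ∑ x, ∑ a', ∑ x', (ρ a a' * batteryState S x x') * g a x a' x' =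
          ∑ a, ∑ a', ∑ x ∈ S, ρ a a' * (S.card : ℂ)⁻¹ * g a x a' x := fun g => by
        refine Finset.sum_congr rfl fun a _ => ?_
        rw [Finset.sum_comm]
        refine Finset.sum_congr rfl fun a' _ => ?_
        simp only [batteryState, Matrix.diagonal_apply, mul_ite, mul_zero, ite_mul, zero_mul,
          Finset.sum_ite_eq, Finset.mem_univ, if_true, Finset.sum_ite_mem, Finset.univ_inter]
      simp only [permutationChannel, LinearMap.coe_mk, AddHom.coe_mk, Matrix.of_apply,
        Fintype.sum_prod_type, Matrix.kroneckerMap_apply]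
      exact this _
    rw [hL]
    have hc : ∀ a a', ∀ x ∈ S,
        permCoeff kT (resetBath E ω S') (resetPerm τ S') p q (a, x) (a', x) = _ :=
      fun a a' x hx => permCoeff_resetPerm hω hS' (fun b j => hSS' b x hx j) p q a a'
    have h2 : ∀ a a', ∑ x ∈ S, ρ a a' * (S.card : ℂ)⁻¹ *
        (permCoeff kT (resetBath E ω S') (resetPerm τ S') p q (a, x) (a', x) : ℂ) =
        if a = a' then (if p = q ∧ p.2 ∈ S' then
          ρ a a' * (S'.card : ℂ)⁻¹ * (outputWeight kT E ω τ S p.1 : ℂ) else 0) else 0 := by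
      intro a a'
      by_cases h : a = a' ∧ p = q ∧ p.2 ∈ S'
      · rw [if_pos h.1, if_pos h.2, outputWeight,
          Finset.sum_congr rfl fun x hx => by rw [hc a a' x hx, if_pos h]]
        rw [Complex.ofReal_mul, Complex.ofReal_sum, Finset.mul_sum, Finset.mul_sum]
        refine Finset.sum_congr rfl fun x _ => ?_
        rw [Complex.ofReal_mul, Complex.ofReal_inv, Complex.ofReal_inv, Complex.ofReal_natCast,
          Complex.ofReal_natCast]
        ring
      · rw [← ite_and, if_neg h]
        exact Finset.sum_eq_zero fun x hx => by
          rw [hc a a' x hx, if_neg h, Complex.ofReal_zero, mul_zero]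
    simp only [h2, Finset.sum_ite_eq, Finset.mem_univ, if_true]
    by_cases hpq : p = q
    · subst hpq
      by_cases hp : p.2 ∈ S' <;> simp [hp, batteryState, Matrix.trace, Finset.sum_mul]
      refine Finset.sum_congr rfl fun a _ => ?_
      ring
    · have : p.1 ≠ q.1 ∨ p.2 ≠ q.2 := by
        by_contra! h
        exact hpq (Prod.ext h.1 h.2)
      rcases this with h | h <;> simp [hpq, batteryState, Matrix.diagonal_apply_ne _ h]

end Reset

/-! ### Raising the energy of an infinite bath -/

section Bath

variable {kT : ℝ}

/-- A bath that absorbs the energy `Δ`, while the number of microstates of a degenerate system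
changes from `u` to any `v > u exp (-Δ / kT)`. For `Δ > 0` the bath is a ladder with spacing `Δ`
whose `k`-th level is `⌈C y ^ k⌉`-fold degenerate. The growth rate `y` has to exceed `u / v`, so
that level `k` together with `u` states fits into level `k + 1` together with `v` states, and to
be less than `exp (Δ / kT)`, so that the partition function converges; the constant `C`
compensates for the rounding. There is no top level, where the map would have to stop. -/
theorem exists_raising_bath (hkT : 0 < kT) {Δ : ℝ} (hΔ : 0 ≤ Δ) {u v : ℕ}
    (h : u * Real.exp (-Δ / kT) < v) :
    ∃ (ι : Type) (ω : ι → ℝ) (g : Fin u × ι → Fin v × ι), Nonempty ι ∧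
      Summable (fun j => Real.exp (-ω j / kT)) ∧ Function.Injective g ∧
      ∀ z, ω (g z).2 = Δ + ω z.2 := by
  rcases hΔ.eq_or_lt with rfl | hΔ
  · have huv : u ≤ v := by
      have : (u : ℝ) < v := by simpa using h
      exact_mod_cast this.le
    refine ⟨Unit, fun _ => 0, fun z => (Fin.castLE huv z.1, ()), inferInstance, .of_finite,
      fun z z' hz => ?_, by simp⟩
    exact Prod.ext (Fin.castLE_injective huv (Prod.ext_iff.1 hz).1) rfl
  set x := Real.exp (-Δ / kT) with hx
  have hx0 : 0 < x := Real.exp_pos _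
  have hx1 : x < 1 := Real.exp_lt_one_iff.2 (div_neg_of_neg_of_pos (neg_neg_of_pos hΔ) hkT)
  have hv : (0 : ℝ) < v := lt_of_le_of_lt (by positivity) h
  obtain ⟨y, hy1, hyx⟩ := exists_between (show max 1 ((u : ℝ) / v) < x⁻¹ from
    max_lt ((one_lt_inv₀ hx0).2 hx1)
      (by rw [div_lt_iff₀ hv, inv_mul_eq_div, lt_div_iff₀ hx0]; exact h))
  obtain ⟨hy1, hyu⟩ := max_lt_iff.1 hy1
  rw [div_lt_iff₀ hv] at hyu
  have hy0 : 0 < y := one_pos.trans hy1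
  have hyx1 : y * x < 1 := by rwa [lt_inv_comm₀ hy0 hx0, lt_inv_comm₀ hx0 hy0, ← one_div,
    lt_div_iff₀ hx0] at hyx
  set C : ℝ := u / (y * v - u) + 1 with hC
  have hd : 0 < y * v - u := sub_pos.2 hyu
  have hC0 : 0 < C := by positivity
  have hCu : u ≤ C * (y * v - u) := by
    rw [hC, add_mul, div_mul_cancel₀ _ hd.ne']
    linarith
  let N : ℕ → ℕ := fun k => ⌈C * y ^ k⌉₊
  have hN : ∀ k, u * N k ≤ v * N (k + 1) := fun k => by
    have h1 : (N k : ℝ) ≤ C * y ^ k + 1 := (Nat.ceil_lt_add_one (by positivity)).le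
    have h2 : C * y ^ (k + 1) ≤ N (k + 1) := Nat.le_ceil _
    have h3 : (1 : ℝ) ≤ y ^ k := one_le_pow₀ hy1.le
    have h4 : (u : ℝ) ≤ C * (y * v - u) * y ^ k :=
      hCu.trans (le_mul_of_one_le_right (by positivity) h3)
    have : (u : ℝ) * N k ≤ v * N (k + 1) := calc
      (u : ℝ) * N k ≤ u * (C * y ^ k + 1) := by gcongr
      _ ≤ v * (C * y ^ (k + 1)) := by rw [pow_succ]; linarith
      _ ≤ v * N (k + 1) := by gcongr
    exact_mod_cast this
  have hemb : ∀ k, Nonempty (Fin u × Fin (N k) ↪ Fin v × Fin (N (k + 1))) := fun k =>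
    Function.Embedding.nonempty_of_card_le (by simpa using hN k)
  let e := fun k => (hemb k).some
  refine ⟨Σ k, Fin (N k), fun j => j.1 * Δ,
    fun z => ((e z.2.1 (z.1, z.2.2)).1, ⟨z.2.1 + 1, (e z.2.1 (z.1, z.2.2)).2⟩), ?_, ?_, ?_, ?_⟩
  · exact ⟨⟨0, ⟨0, Nat.ceil_pos.2 (by positivity)⟩⟩⟩
  · have hexp : ∀ k : ℕ, Real.exp (-(k * Δ) / kT) = x ^ k := fun k => by
      rw [hx, ← Real.exp_nat_mul]
      ring_nf
    simp only [hexp]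
    refine (summable_sigma_of_nonneg fun _ => by positivity).2 ⟨fun k => .of_finite, ?_⟩
    refine Summable.of_nonneg_of_le (fun k => tsum_nonneg fun _ => by positivity) (fun k => ?_)
      (((summable_geometric_of_lt_one (by positivity) hyx1).mul_left C).add
        (summable_geometric_of_lt_one hx0.le hx1))
    have h1 : (N k : ℝ) ≤ C * y ^ k + 1 := (Nat.ceil_lt_add_one (by positivity)).le
    rw [tsum_fintype]
    dsimp only
    rw [Finset.sum_const, Finset.card_univ, Fintype.card_fin, nsmul_eq_mul, mul_pow]
    calc (N k : ℝ) * x ^ k ≤ (C * y ^ k + 1) * x ^ k := by gcongr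
      _ = _ := by ring
  · rintro ⟨a, k, j⟩ ⟨a', k', j'⟩ hz
    simp only [Prod.mk.injEq, Sigma.mk.injEq, add_left_inj] at hz
    obtain ⟨h1, rfl, h2⟩ := hz
    have := (e k).injective (Prod.ext h1 (eq_of_heq h2))
    simp only [Prod.mk.injEq] at this
    rw [this.1, this.2]
  · intro z
    push_cast
    ring

/-- A product of baths as in `exists_raising_bath`, which absorbs any of finitely many energies. -/
theorem exists_raising_bath_family {α : Type} (hkT : 0 < kT) {Δ : α → ℝ} (hΔ : ∀ b, 0 ≤ Δ b)
    {u : ℕ} {v : α → ℕ} (h : ∀ b, u * Real.exp (-Δ b / kT) < v b) (s : Finset α) :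
    ∃ (ι : Type) (ω : ι → ℝ), Nonempty ι ∧ Summable (fun j => Real.exp (-ω j / kT)) ∧
      ∀ b ∈ s, ∃ g : Fin u × ι → Fin (v b) × ι, Function.Injective g ∧
        ∀ z, ω (g z).2 = Δ b + ω z.2 := by
  classical
  induction s using Finset.induction_on with
  | empty => exact ⟨Unit, fun _ => 0, inferInstance, .of_finite, by simp⟩
  | insert b s _ ih =>
    obtain ⟨ι, ω, hι, hω, hg⟩ := ih
    obtain ⟨κ, ω', g', hκ, hω', hg', hE'⟩ := exists_raising_bath hkT (hΔ b) (h b)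
    refine ⟨ι × κ, fun p => ω p.1 + ω' p.2, inferInstance, summable_exp_prod hω hω', ?_⟩
    intro c hc
    by_cases hcb : c = b
    · subst hcb
      refine ⟨fun z => ((g' (z.1, z.2.2)).1, (z.2.1, (g' (z.1, z.2.2)).2)), ?_, fun z => ?_⟩
      · rintro ⟨a, j, k⟩ ⟨a', j', k'⟩ hz
        simp only [Prod.mk.injEq] at hz
        have := hg' (Prod.ext hz.1 hz.2.2)
        simp only [Prod.mk.injEq] at this
        rw [this.1, this.2, hz.2.1]
      · have := hE' (z.1, z.2.2)
        simp only at this ⊢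
        linarith
    · obtain ⟨g, hgi, hgE⟩ := hg c (Finset.mem_of_mem_insert_of_ne hc hcb)
      refine ⟨fun z => ((g (z.1, z.2.1)).1, ((g (z.1, z.2.1)).2, z.2.2)), ?_, fun z => ?_⟩
      · rintro ⟨a, j, k⟩ ⟨a', j', k'⟩ hz
        simp only [Prod.mk.injEq] at hz
        have := hgi (Prod.ext hz.1 hz.2.1)
        simp only [Prod.mk.injEq] at this
        rw [this.1, this.2, hz.2.2]
      · have := hgE (z.1, z.2.1)
        simp only at this ⊢
        linarith

theorem tsum_gibbsWeight_mul {ι κ : Type} [Nonempty ι] [Fintype κ] {ω : ι → ℝ}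
    (hω : Summable fun j => Real.exp (-ω j / kT)) (g : κ → ℝ) :
    ∑' j : ι × κ, gibbsWeight kT ω j.1 * g j.2 = ∑ c, g c := by
  have h := hasSum_gibbsWeight hω
  have hprod := h.mul (hasSum_fintype g) (summable_mul_of_summable_norm h.summable.norm .of_finite)
  rw [hprod.tsum_eq, one_mul]

/-- A two-level bath is a coin of arbitrary bias `q`. For `q = 0` and `q = 1` no finite energies
give the bias, and the event is trivial instead. -/
theorem exists_coin (hkT : 0 < kT) {q : ℝ} (hq0 : 0 ≤ q) (hq1 : q ≤ 1) :
    ∃ (ω : Bool → ℝ) (heads : Bool → Bool),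
      ∑ c, (if heads c then gibbsWeight kT ω c else 0) = q := by
  rcases hq0.eq_or_lt with rfl | hq0
  · exact ⟨fun _ => 0, fun _ => false, by simp⟩
  rcases hq1.eq_or_lt with rfl | hq1
  · exact ⟨fun _ => 0, fun _ => true, by simpa using sum_gibbsWeight kT fun _ : Bool => (0 : ℝ)⟩
  refine ⟨fun c => -kT * Real.log (if c then q else 1 - q), id, ?_⟩
  have h : ∀ p : ℝ, 0 < p → Real.exp (-(-kT * Real.log p) / kT) = p := fun p hp => by
    rw [show -(-kT * Real.log p) / kT = Real.log p by field_simp, Real.exp_log hp]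
  simp only [id, Fintype.sum_bool, if_true, gibbsWeight, tsum_fintype, Bool.false_eq_true, if_false,
    h q hq0, h (1 - q) (by linarith)]
  simp

end Bath

/-! ### The erasing permutation -/

section Erasing

variable {α : Type} [Fintype α] [DecidableEq α] {kT : ℝ} {E : α → ℝ}

/-- Basis states of the battery are labelled by `x ∈ Fin t`, `x ∈ Fin u` and `y ∈ Σ b, Fin (v b)`.
The permutation leaves alone the first kind, and exchanges the second kind with part of the third.
Depending on a coin of bias `q` (heads), it either leaves the system alone or, when its state is
`b`, sets it to `i`, records `b` in the battery, and passes the energy difference to the bath. -/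
theorem exists_erasing_permutation [Nonempty α] (hkT : 0 < kT) {i : α} (hE : ∀ b, E i ≤ E b)
    {t u n : ℕ} {v : α → ℕ} (hv : ∀ b, u * Real.exp (-(E b - E i) / kT) < v b)
    {q : ℝ} (hq0 : 0 ≤ q) (hq1 : q ≤ 1)
    (e : Fin t ⊕ Fin u ⊕ (Σ b, Fin (v b)) ↪ Qubits n) :
    ∃ (ι : Type) (ω : ι → ℝ) (τ : Equiv.Perm ((α × Qubits n) × ι)), Nonempty ι ∧
      Summable (fun j => Real.exp (-ω j / kT)) ∧
      (∀ z, E (τ z).1.1 + ω (τ z).2 = E z.1.1 + ω z.2) ∧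
      (∀ b x j, τ ((b, e (.inl x)), j) = ((b, e (.inl x)), j)) ∧
      (∀ b x j, ∃ y, (τ ((b, e (.inr (.inl x))), j)).1.2 = e (.inr (.inr y))) ∧
      ∀ b x a, (∑' j, if (τ ((b, e (.inr (.inl x))), j)).1.1 = a then gibbsWeight kT ω j else 0) =
        q * (if b = a then 1 else 0) + (1 - q) * (if i = a then 1 else 0) := by
  obtain ⟨ι, ω, hι, hω, hg⟩ := exists_raising_bath_family hkT
    (fun b => sub_nonneg.2 (hE b)) hv Finset.univ
  choose g hgi hgE using fun b => hg b (Finset.mem_univ b)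
  obtain ⟨ω', heads, hcoin⟩ := exists_coin hkT hq0 hq1
  have huv : u ≤ v i := by
    have h := hv i
    rw [sub_self, neg_zero, zero_div, Real.exp_zero, mul_one] at h
    exact_mod_cast h.le
  -- the states with battery label in `Fin u`, and the states with which they are exchanged
  let f₁ : α × Fin u × ι × Bool → (α × Qubits n) × (ι × Bool) := fun z =>
    ((z.1, e (.inr (.inl z.2.1))), z.2.2)
  let f₂ : α × Fin u × ι × Bool → (α × Qubits n) × (ι × Bool) := fun z =>
    if heads z.2.2.2 then ((z.1, e (.inr (.inr ⟨i, Fin.castLE huv z.2.1⟩))), z.2.2)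
    else ((i, e (.inr (.inr ⟨z.1, (g z.1 (z.2.1, z.2.2.1)).1⟩))),
      ((g z.1 (z.2.1, z.2.2.1)).2, z.2.2.2))
  have hf₂snd : ∀ z, ∃ y, (f₂ z).1.2 = e (.inr (.inr y)) := fun z => by
    simp only [f₂]
    split_ifs <;> exact ⟨_, rfl⟩
  have hf₂c : ∀ z, (f₂ z).2.2 = z.2.2.2 := fun z => by
    simp only [f₂]
    split_ifs <;> rfl
  have hf₁ : Function.Injective f₁ := by
    rintro ⟨b, x, j⟩ ⟨b', x', j'⟩ h
    simp only [f₁, Prod.mk.injEq, e.injective.eq_iff, Sum.inr.injEq, Sum.inl.injEq] at h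
    rw [h.1.1, h.1.2, h.2]
  have hf₂ : Function.Injective f₂ := by
    rintro ⟨b, x, j, c⟩ ⟨b', x', j', c'⟩ h
    have hc : c = c' :=
      (hf₂c (b, x, j, c)).symm.trans ((congrArg (fun z => z.2.2) h).trans (hf₂c _))
    subst hc
    simp only [f₂] at h
    split_ifs at h with hh
    · simp only [Prod.mk.injEq, e.injective.eq_iff, Sum.inr.injEq, Sigma.mk.injEq, true_and,
        heq_eq_eq, (Fin.castLE_injective huv).eq_iff, and_true] at h
      rw [h.1.1, h.1.2, h.2]
    · simp only [Prod.mk.injEq, e.injective.eq_iff, Sum.inr.injEq, Sigma.mk.injEq, true_and,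
        and_true] at h
      obtain ⟨⟨rfl, h1⟩, h2⟩ := h
      have := hgi b (Prod.ext (eq_of_heq h1) h2)
      simp only [Prod.mk.injEq] at this
      rw [this.1, this.2]
  have hdisj : ∀ z z', f₁ z ≠ f₂ z' := fun z z' h => by
    obtain ⟨y, hy⟩ := hf₂snd z'
    rw [← h] at hy
    simpa using e.injective hy
  let F : (α × Fin u × ι × Bool) ⊕ (α × Fin u × ι × Bool) ↪ (α × Qubits n) × (ι × Bool) :=
    ⟨Sum.elim f₁ f₂, hf₁.sumElim hf₂ hdisj⟩
  let τ : Equiv.Perm ((α × Qubits n) × (ι × Bool)) :=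
    Equiv.Perm.viaEmbedding (Equiv.sumComm _ _) F
  have hτ₁ : ∀ z, τ (f₁ z) = f₂ z := fun z =>
    Equiv.Perm.viaEmbedding_apply (Equiv.sumComm _ _) F (.inl z)
  have hτ₂ : ∀ z, τ (f₂ z) = f₁ z := fun z =>
    Equiv.Perm.viaEmbedding_apply (Equiv.sumComm _ _) F (.inr z)
  have hτ₀ : ∀ z, z ∉ Set.range F → τ z = z := fun z hz =>
    Equiv.Perm.viaEmbedding_apply_of_notMem _ F z hz
  have henergy : ∀ z, E (f₂ z).1.1 + (ω (f₂ z).2.1 + ω' (f₂ z).2.2) =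
      E (f₁ z).1.1 + (ω (f₁ z).2.1 + ω' (f₁ z).2.2) := fun z => by
    simp only [f₂, f₁]
    split_ifs
    · rfl
    · simp only [hgE]
      ring
  have hω' : Summable fun c => Real.exp (-ω' c / kT) := .of_finite
  have hτu : ∀ b x j, τ ((b, e (.inr (.inl x))), j) = f₂ (b, x, j) := fun b x j => hτ₁ (b, x, j)
  refine ⟨ι × Bool, fun j => ω j.1 + ω' j.2, τ, inferInstance, summable_exp_prod hω hω',
    fun z => ?_, fun b x j => ?_, fun b x j => ?_, fun b x a => ?_⟩
  · by_cases hz : z ∈ Set.range F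
    · obtain ⟨w | w, rfl⟩ := hz
      · exact (congrArg (fun z => E z.1.1 + (ω z.2.1 + ω' z.2.2)) (hτ₁ w)).trans (henergy w)
      · exact (congrArg (fun z => E z.1.1 + (ω z.2.1 + ω' z.2.2)) (hτ₂ w)).trans (henergy w).symm
    · rw [hτ₀ z hz]
  · refine hτ₀ _ ?_
    rintro ⟨w | w, hw⟩
    · have := e.injective (congrArg (fun z => z.1.2) hw)
      simp at this
    · obtain ⟨y, hy⟩ := hf₂snd w
      have := e.injective (hy.symm.trans (congrArg (fun z => z.1.2) hw))
      simp at this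
  · rw [hτu]
    exact hf₂snd _
  · have hval : ∀ j : ι × Bool, (if (τ ((b, e (.inr (.inl x))), j)).1.1 = a then
        gibbsWeight kT (fun j : ι × Bool => ω j.1 + ω' j.2) j else 0) =
        gibbsWeight kT ω j.1 * ((if heads j.2 then gibbsWeight kT ω' j.2 else 0) *
          (if b = a then 1 else 0) + (gibbsWeight kT ω' j.2 -
            if heads j.2 then gibbsWeight kT ω' j.2 else 0) * (if i = a then 1 else 0)) :=
      fun j => by
      rw [hτu, gibbsWeight_prod hω hω']
      by_cases hh : heads j.2
      · have : (f₂ (b, x, j)).1.1 = b := by simp only [f₂, hh, if_true]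
        rw [this]
        simp [hh]
      · have : (f₂ (b, x, j)).1.1 = i := by simp only [f₂, if_neg hh]
        rw [this]
        simp [hh]
    have hcoin' : ∑ c, ((if heads c then gibbsWeight kT ω' c else 0) *
          (if b = a then 1 else 0) + (gibbsWeight kT ω' c -
            if heads c then gibbsWeight kT ω' c else 0) * (if i = a then 1 else 0)) =
        q * (if b = a then 1 else 0) + (1 - q) * (if i = a then 1 else 0) := by
      rw [Finset.sum_add_distrib, ← Finset.sum_mul, ← Finset.sum_mul, Finset.sum_sub_distrib,
        hcoin, sum_gibbsWeight]
    refine (tsum_congr hval).trans ?_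
    rw [← hcoin']
    exact tsum_gibbsWeight_mul hω fun c => (if heads c then gibbsWeight kT ω' c else 0) *
      (if b = a then 1 else 0) + (gibbsWeight kT ω' c -
        if heads c then gibbsWeight kT ω' c else 0) * (if i = a then 1 else 0)

end Erasing

/-! ### Optimal erasure -/

section Optimal

theorem inv_gibbsWeight {α : Type} [Fintype α] (kT : ℝ) (E : α → ℝ) (i : α) :
    (gibbsWeight kT E i)⁻¹ = ∑ b, Real.exp (-(E b - E i) / kT) := by
  rw [gibbsWeight, inv_div, tsum_fintype, Finset.sum_div]
  refine Finset.sum_congr rfl fun b _ => ?_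
  rw [← Real.exp_sub]
  ring_nf

variable {α : Type} [Fintype α] [DecidableEq α] {kT : ℝ} {E : α → ℝ} {i : α}

/-- The channel that replaces every state by the mixture of the Gibbs state, with weight `r`, and
of `|i⟩⟨i|`. -/
def erasureChannel (kT : ℝ) (E : α → ℝ) (i : α) (r : ℝ) : Matrix α α ℂ →ₗ[ℂ] Matrix α α ℂ :=
  (Matrix.traceLinearMap α ℂ ℂ).smulRight
    (Matrix.diagonal fun a => ((r * gibbsWeight kT E a + (1 - r) * if i = a then 1 else 0 : ℝ) : ℂ))

theorem isChannel_erasureChannel [Nonempty α] {r : ℝ} (hr0 : 0 ≤ r) (hr1 : r ≤ 1) :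
    IsChannel (erasureChannel kT E i r) := by
  refine isChannel_trace_smul (Matrix.posSemidef_diagonal_iff.2 fun a => ?_) ?_
  · have := gibbsWeight_nonneg kT E a
    have := sub_nonneg.2 hr1
    rw [Complex.zero_le_real]
    split_ifs <;> positivity
  · rw [Matrix.trace_diagonal, ← Complex.ofReal_sum, Finset.sum_add_distrib, ← Finset.mul_sum,
      ← Finset.mul_sum, sum_gibbsWeight]
    simp

theorem accuracy_erasureChannel (r : ℝ) :
    (erasure i).accuracy (erasureChannel kT E i r) = r * gibbsWeight kT E i + (1 - r) := by
  rw [erasureChannel, erasure_accuracy_trace_smul, Matrix.diagonal_apply_eq, Complex.ofReal_re,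
    if_pos rfl, mul_one]

/-- Implementations of `erasureChannel` whose consumption approaches the lower bound. For a battery
with `m` labels in `S`, a number `t ≈ r m` of them is left alone together with the system. The other
`u = m - t` labels are turned into little more than `u exp (-(E b - E i) / kT)` labels for each
state `b` of the system, a total of about `u / Γ_i` labels. The coin compensates for the rounding
of `r m`. -/
theorem exists_thermal_implements_erasureChannel [Nonempty α] (hkT : 0 < kT)
    (hE : ∀ b, E i ≤ E b) {r : ℝ} (hr0 : 0 ≤ r) (hr1 : r ≤ 1) {m : ℕ} (hm : 0 < m) :
    ∃ (n : ℕ) (S S' : Finset (Qubits n))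
      (Φ : Matrix (α × Qubits n) (α × Qubits n) ℂ →ₗ[ℂ] Matrix (α × Qubits n) (α × Qubits n) ℂ),
      S.Nonempty ∧ S'.Nonempty ∧ IsThermalOperation kT (withBattery E n) Φ ∧
      Implements Φ S S' (erasureChannel kT E i r) ∧
      (S'.card / S.card : ℝ) ≤ r + (1 - r) * (gibbsWeight kT E i)⁻¹ +
        ((gibbsWeight kT E i)⁻¹ + Fintype.card α) / m := by
  have hm' : (0 : ℝ) < m := by exact_mod_cast hm
  set t : ℕ := ⌊r * m⌋₊ with ht
  have ht1 : (t : ℝ) ≤ r * m := Nat.floor_le (by positivity)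
  have ht2 : r * m < t + 1 := Nat.lt_floor_add_one _
  have htm : t ≤ m := by
    have : (t : ℝ) ≤ m := ht1.trans (mul_le_of_le_one_left hm'.le hr1)
    exact_mod_cast this
  obtain ⟨u, hu⟩ := Nat.exists_eq_add_of_le htm
  have hu' : (m : ℝ) = t + u := by exact_mod_cast hu
  have hrm : r * m - t ≤ u := by
    have := mul_le_of_le_one_left hm'.le hr1
    linarith
  set q : ℝ := (r * m - t) / u with hq
  have hq0 : 0 ≤ q := div_nonneg (sub_nonneg.2 ht1) (Nat.cast_nonneg _)
  have hq1 : q ≤ 1 := div_le_one_of_le₀ hrm (Nat.cast_nonneg _)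
  have huq : u * q = r * m - t := by
    rcases Nat.eq_zero_or_pos u with h0 | h0
    · rw [h0, Nat.cast_zero] at hrm
      rw [h0, Nat.cast_zero, zero_mul]
      linarith
    · rw [hq, mul_div_cancel₀]
      exact_mod_cast h0.ne'
  let v : α → ℕ := fun b => ⌊u * Real.exp (-(E b - E i) / kT)⌋₊ + 1
  have hv : ∀ b, u * Real.exp (-(E b - E i) / kT) < v b := fun b => by
    simpa [v] using Nat.lt_floor_add_one (u * Real.exp (-(E b - E i) / kT))
  let n : ℕ := Fintype.card (Fin t ⊕ Fin u ⊕ (Σ b, Fin (v b)))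
  have hemb : Nonempty (Fin t ⊕ Fin u ⊕ (Σ b, Fin (v b)) ↪ Qubits n) :=
    Function.Embedding.nonempty_of_card_le (by
      rw [Fintype.card_fun, Fintype.card_fin, Fintype.card_fin]
      exact Nat.lt_two_pow_self.le)
  obtain ⟨e⟩ := hemb
  obtain ⟨ι, ω, τ, hι, hω, hτE, hτt, hτu, hτw⟩ := exists_erasing_permutation hkT hE hv hq0 hq1 e
  let S : Finset (Qubits n) := Finset.univ.map
    (((Function.Embedding.refl (Fin t)).sumMap Function.Embedding.inl).trans e)
  let S' : Finset (Qubits n) := Finset.univ.map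
    (((Function.Embedding.refl (Fin t)).sumMap Function.Embedding.inr).trans e)
  have hScard : (S.card : ℝ) = m := by
    simp [S, hu']
  have hS'card : (S'.card : ℝ) = t + ∑ b, (v b : ℝ) := by
    simp [S']
  have hS : S.Nonempty := by
    rw [← Finset.card_pos]
    have : (0 : ℝ) < S.card := hScard ▸ hm'
    exact_mod_cast this
  have hS' : S'.Nonempty :=
    ⟨e (.inr (.inr ⟨i, ⟨0, Nat.succ_pos _⟩⟩)), Finset.mem_map.2 ⟨.inr ⟨i, ⟨0, Nat.succ_pos _⟩⟩,
      Finset.mem_univ _, rfl⟩⟩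
  have hSS' : ∀ b, ∀ x ∈ S, ∀ j, (τ ((b, x), j)).1.2 ∈ S' := by
    intro b x hx j
    obtain ⟨z | z, -, rfl⟩ := Finset.mem_map.1 hx
    · refine Finset.mem_map.2 ⟨.inl z, Finset.mem_univ _, ?_⟩
      exact (congrArg (fun z => z.1.2) (hτt b z j)).symm
    · obtain ⟨y, hy⟩ := hτu b z j
      exact Finset.mem_map.2 ⟨.inr y, Finset.mem_univ _, hy.symm⟩
  obtain ⟨Φ, hΦ, himp⟩ := exists_thermal_implements_trace_smul hω τ hτE hS' hSS'
  have hout : ∀ a, outputWeight kT E ω τ S a =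
      r * gibbsWeight kT E a + (1 - r) * if i = a then 1 else 0 := by
    intro a
    have h1 : ∀ z : Fin t, ∑ b, gibbsWeight kT E b *
        (∑' j, if (τ ((b, e (.inl z)), j)).1.1 = a then gibbsWeight kT ω j else 0) =
        gibbsWeight kT E a := fun z => by
      simp only [hτt]
      rw [Finset.sum_eq_single a]
      · simp [(hasSum_gibbsWeight hω).tsum_eq]
      · intro b _ hb
        simp [hb]
      · simp
    have h2 : ∀ z : Fin u, ∑ b, gibbsWeight kT E b *
        (∑' j, if (τ ((b, e (.inr (.inl z))), j)).1.1 = a then gibbsWeight kT ω j else 0) =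
        q * gibbsWeight kT E a + (1 - q) * if i = a then 1 else 0 := fun z => by
      simp only [hτw, mul_add, Finset.sum_add_distrib, ← Finset.sum_mul, sum_gibbsWeight, one_mul]
      simp [mul_comm]
    rw [outputWeight, hScard, Finset.sum_map, Fintype.sum_sum_type]
    calc (m : ℝ)⁻¹ * (∑ _z : Fin t, _ + ∑ _z : Fin u, _)
        = (m : ℝ)⁻¹ * (∑ _z : Fin t, gibbsWeight kT E a + ∑ _z : Fin u,
          (q * gibbsWeight kT E a + (1 - q) * if i = a then 1 else 0)) := by
          congr 2
          · exact Finset.sum_congr rfl fun z _ => h1 z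
          · exact Finset.sum_congr rfl fun z _ => h2 z
      _ = (m : ℝ)⁻¹ * ((t + u * q) * gibbsWeight kT E a +
            (u - u * q) * if i = a then 1 else 0) := by
          simp only [Finset.sum_const, Finset.card_univ, Fintype.card_fin, nsmul_eq_mul]
          ring
      _ = _ := by
          rw [huq, show (u : ℝ) - (r * m - t) = (1 - r) * m by rw [hu']; ring,
            show (t : ℝ) + (r * m - t) = r * m by ring]
          field_simp
  refine ⟨n, S, S', Φ, hS, hS', hΦ, ?_, ?_⟩
  · rw [erasureChannel]
    simpa only [hout] using himp
  · set Z := (gibbsWeight kT E i)⁻¹ with hZ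
    have hZ1 : 1 ≤ Z := (one_le_inv₀ (gibbsWeight_pos' kT E i)).2 (by
      rw [← sum_gibbsWeight kT E]
      exact Finset.single_le_sum (fun b _ => gibbsWeight_nonneg kT E b) (Finset.mem_univ i))
    have hsumv : ∑ b, (v b : ℝ) ≤ u * Z + Fintype.card α := by
      rw [hZ, inv_gibbsWeight, Finset.mul_sum]
      calc ∑ b, (v b : ℝ) ≤ ∑ b, (u * Real.exp (-(E b - E i) / kT) + 1) :=
            Finset.sum_le_sum fun b _ => by
              simpa [v] using Nat.floor_le (by positivity : 0 ≤ u * Real.exp (-(E b - E i) / kT))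
        _ = _ := by simp [Finset.sum_add_distrib]
    rw [hScard, hS'card, div_le_iff₀ hm', add_mul, div_mul_cancel₀ _ hm'.ne']
    have hu2 : (u : ℝ) = m - t := by linarith
    have h3 : 0 ≤ (t + 1 - r * m) * (Z - 1) :=
      mul_nonneg (by linarith) (by linarith)
    rw [hu2] at hsumv
    nlinarith


end Optimal

section Costs

variable {α : Type} [Fintype α] [DecidableEq α] {kT : ℝ} {E : α → ℝ} {i : α}

/-- The lower bounds on the costs of `erasureChannel` are attained, as infima over implementations.
The parameter `F` is the accuracy of the channel. -/
theorem costs_erasureChannel [Nonempty α] (hkT : 0 < kT) (hE : ∀ b, E i ≤ E b) {r F : ℝ}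
    (hr0 : 0 ≤ r) (hr1 : r ≤ 1) (hF : r * gibbsWeight kT E i + (1 - r) = F) :
    neqCost kT E (erasureChannel kT E i r) =
        ((Real.logb 2 (F / gibbsWeight kT E i) : ℝ) : EReal) ∧
      workCost kT E (erasureChannel kT E i r) =
        ((kT * Real.log 2 * Real.logb 2 (F / gibbsWeight kT E i) : ℝ) : EReal) := by
  set γ := gibbsWeight kT E i with hγ
  have hγ0 : 0 < γ := gibbsWeight_pos' kT E i
  have hγ1 : γ ≤ 1 := by
    rw [← sum_gibbsWeight kT E]
    exact Finset.single_le_sum (fun b _ => gibbsWeight_nonneg kT E b) (Finset.mem_univ i)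
  have hγF : γ ≤ F := by
    have := mul_nonneg (sub_nonneg.2 hr1) (sub_nonneg.2 hγ1)
    linarith
  have hF0 : 0 < F := hγ0.trans_le hγF
  have hlow : ((Real.logb 2 (F / γ) : ℝ) : EReal) ≤ neqCost kT E (erasureChannel kT E i r) :=
    logb_le_neqCost hF0 (by
      rw [← hF, ← accuracy_erasureChannel]
      exact erasure_accuracy_le_apply_gibbsState (isChannel_erasureChannel hr0 hr1))
  set K : ℝ := γ⁻¹ + Fintype.card α
  have hL : r + (1 - r) * γ⁻¹ = F / γ := by
    rw [← hF]
    field_simp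
  have himp := fun m : ℕ => exists_thermal_implements_erasureChannel hkT hE hr0 hr1 m.succ_pos
  have hlim : Filter.Tendsto (fun m : ℕ => Real.logb 2 (F / γ + K / ((m.succ : ℕ) : ℝ)))
      Filter.atTop (nhds (Real.logb 2 (F / γ))) := by
    have h1 : Filter.Tendsto (fun m : ℕ => F / γ + K / ((m.succ : ℕ) : ℝ)) Filter.atTop
        (nhds (F / γ)) := by
      simpa using ((tendsto_const_div_atTop_nhds_zero_nat K).comp
        (Filter.tendsto_add_atTop_nat 1)).const_add (F / γ)
    exact (h1.log (div_pos hF0 hγ0).ne').div_const _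
  have hbound : ∀ {n : ℕ} {S S' : Finset (Qubits n)} (m : ℕ), S.Nonempty → S'.Nonempty →
      (S'.card / S.card : ℝ) ≤ r + (1 - r) * γ⁻¹ + K / ((m.succ : ℕ) : ℝ) →
      cleanQubits S - cleanQubits S' ≤ Real.logb 2 (F / γ + K / ((m.succ : ℕ) : ℝ)) :=
    fun {n S S'} m hS hS' h => by
      rw [cleanQubits_sub hS hS', ← hL]
      have h1 : (0 : ℝ) < S.card := by exact_mod_cast hS.card_pos
      have h2 : (0 : ℝ) < S'.card := by exact_mod_cast hS'.card_pos
      exact Real.logb_le_logb_of_le one_lt_two (by positivity) h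
  constructor
  · refine le_antisymm (ge_of_tendsto ((continuous_coe_real_ereal.tendsto _).comp hlim)
      (Filter.Eventually.of_forall fun m => ?_)) hlow
    obtain ⟨n, S, S', Φ, hS, hS', hΦ, hM, hle⟩ := himp m
    exact (neqCost_le_of_implements hS hS' hΦ hM).trans
      (EReal.coe_le_coe_iff.2 (hbound m hS hS' hle))
  · refine le_antisymm (ge_of_tendsto ((continuous_coe_real_ereal.tendsto _).comp
      (hlim.const_mul (kT * Real.log 2))) (Filter.Eventually.of_forall fun m => ?_))
      (logb_le_workCost hkT hlow)
    obtain ⟨n, S, S', Φ, hS, hS', hΦ, hM, hle⟩ := himp m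
    refine (sInf_le ⟨n, S, S', Φ, hS, hS', hΦ, hM, rfl⟩ : workCost kT E _ ≤ _).trans
      (EReal.coe_le_coe_iff.2 ?_)
    have := Real.log_pos one_lt_two
    exact mul_le_mul_of_nonneg_left (hbound m hS hS' hle) (by positivity)

theorem isLeast_costs [Nonempty α] (hkT : 0 < kT) (hE : ∀ b, E i ≤ E b) {F : ℝ}
    (hF : F ∈ Set.Icc (gibbsWeight kT E i) 1) :
    IsLeast ((erasure i).neqCosts kT E F)
        ((Real.logb 2 (F / gibbsWeight kT E i) : ℝ) : EReal) ∧
      IsLeast ((erasure i).workCosts kT E F)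
        ((kT * Real.log 2 * Real.logb 2 (F / gibbsWeight kT E i) : ℝ) : EReal) := by
  have hγ0 : 0 < gibbsWeight kT E i := gibbsWeight_pos' kT E i
  have hF0 : 0 < F := hγ0.trans_le hF.1
  obtain ⟨r, hr0, hr1, hr⟩ : ∃ r : ℝ, 0 ≤ r ∧ r ≤ 1 ∧ r * gibbsWeight kT E i + (1 - r) = F := by
    rcases (hF.1.trans hF.2).eq_or_lt with h | h
    · exact ⟨0, le_rfl, zero_le_one, by linarith [hF.1, hF.2]⟩
    · have h' := sub_pos.2 h
      refine ⟨(1 - F) / (1 - gibbsWeight kT E i), div_nonneg (sub_nonneg.2 hF.2) h'.le,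
        (div_le_one h').2 (by linarith [hF.1]), ?_⟩
      field_simp
      ring
  have hcost := costs_erasureChannel hkT hE hr0 hr1 hr
  have hch : IsChannel (erasureChannel kT E i r) := isChannel_erasureChannel hr0 hr1
  have hacc : F ≤ (erasure i).accuracy (erasureChannel kT E i r) := by
    rw [accuracy_erasureChannel, hr]
  have hlow : ∀ M, IsChannel M → F ≤ (erasure i).accuracy M →
      ((Real.logb 2 (F / gibbsWeight kT E i) : ℝ) : EReal) ≤ neqCost kT E M := fun M hM hFM =>
    logb_le_neqCost hF0 (hFM.trans (erasure_accuracy_le_apply_gibbsState hM))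
  refine ⟨⟨⟨_, hch, hacc, hcost.1.symm⟩, ?_⟩, ⟨⟨_, hch, hacc, hcost.2.symm⟩, ?_⟩⟩
  · rintro _ ⟨M, hM, hFM, rfl⟩
    exact hlow M hM hFM
  · rintro _ ⟨M, hM, hFM, rfl⟩
    exact logb_le_workCost hkT (hlow M hM hFM)

/-- Without consumption of clean qubits, nothing is more accurate than to thermalize the system. -/
theorem isGreatest_accuracy_of_minNeqCost [Nonempty α] (hkT : 0 < kT) (hE : ∀ b, E i ≤ E b) :
    IsGreatest {f | ∃ M : Matrix α α ℂ →ₗ[ℂ] Matrix α α ℂ, IsChannel M ∧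
      neqCost kT E M ≤ minNeqCost kT E ∧ f = (erasure i).accuracy M} (gibbsWeight kT E i) := by
  have hγ0 : 0 < gibbsWeight kT E i := gibbsWeight_pos' kT E i
  have hch : IsChannel (erasureChannel kT E i 1) := isChannel_erasureChannel zero_le_one le_rfl
  have hcost : neqCost kT E (erasureChannel kT E i 1) = 0 := by
    rw [(costs_erasureChannel hkT hE zero_le_one le_rfl (by ring)).1, div_self hγ0.ne',
      Real.logb_one, EReal.coe_zero]
  refine ⟨⟨_, hch, ?_, ?_⟩, ?_⟩
  · rw [hcost]
    refine le_sInf ?_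
    rintro _ ⟨M, hM, rfl⟩
    exact neqCost_nonneg hM
  · rw [accuracy_erasureChannel]
    ring
  · rintro _ ⟨M, hM, hmin, rfl⟩
    by_contra! hlt
    have h1 : neqCost kT E M ≤ 0 := hcost ▸ hmin.trans (sInf_le ⟨_, hch, rfl⟩)
    have h2 := (logb_le_neqCost (hγ0.trans hlt)
      (erasure_accuracy_le_apply_gibbsState (E := E) (kT := kT) hM)).trans h1
    rw [← EReal.coe_zero, EReal.coe_le_coe_iff] at h2
    exact absurd h2 (not_le.2 (Real.logb_pos one_lt_two ((one_lt_div hγ0).2 hlt)))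

theorem isGreatest_accuracy [Nonempty α] (i : α) :
    IsGreatest {f | ∃ M : Matrix α α ℂ →ₗ[ℂ] Matrix α α ℂ,
      IsChannel M ∧ f = (erasure i).accuracy M} 1 := by
  refine ⟨⟨erasureChannel 0 0 i 0, isChannel_erasureChannel le_rfl zero_le_one, ?_⟩, ?_⟩
  · rw [accuracy_erasureChannel]
    ring
  · rintro _ ⟨M, hM, rfl⟩
    exact erasure_accuracy_le_one hM

end Costs

end ErasureCost

end

theorem mainTheorem7 (d : ℕ) [NeZero d] (E : Fin d → ℝ) (hE : ∀ i, E 0 ≤ E i)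
    (k T : ℝ) (hk : 0 < k) (hT : 0 < T) :
    let kT : ℝ := k * T
    let 𝒯 : ErasureCost.Task (Fin d) := ErasureCost.erasure 0
    let ΔA : ℝ := ErasureCost.freeEnergyGap kT E 0
    let κ : ℝ := 𝒯.reverseEntropy kT E
    let Fmin : ℝ := Real.exp (-ΔA / kT)
    κ = ΔA / (kT * Real.log 2) ∧
    Fmin = (2 : ℝ) ^ (-κ) ∧
    IsGreatest {f | ∃ M : Matrix (Fin d) (Fin d) ℂ →ₗ[ℂ] Matrix (Fin d) (Fin d) ℂ,
      ErasureCost.IsChannel M ∧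
      ErasureCost.neqCost kT E M ≤ ErasureCost.minNeqCost kT E ∧ f = 𝒯.accuracy M} Fmin ∧
    IsGreatest {f | ∃ M : Matrix (Fin d) (Fin d) ℂ →ₗ[ℂ] Matrix (Fin d) (Fin d) ℂ,
      ErasureCost.IsChannel M ∧ f = 𝒯.accuracy M} 1 ∧
    ∀ F ∈ Set.Icc Fmin 1,
      IsLeast (𝒯.neqCosts kT E F) (𝒯.neqCostOf kT E F) ∧
      IsLeast (𝒯.workCosts kT E F) (𝒯.workCostOf kT E F) ∧
      𝒯.neqCostOf kT E F = ((κ + Real.logb 2 F : ℝ) : EReal) ∧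
      𝒯.neqCostOf kT E F = ((ΔA / (kT * Real.log 2) + Real.logb 2 F : ℝ) : EReal) ∧
      𝒯.workCostOf kT E F = ((kT * Real.log 2 : ℝ) : EReal) * 𝒯.neqCostOf kT E F ∧
      𝒯.workCostOf kT E F = ((ΔA + kT * Real.log F : ℝ) : EReal) := by
  intro kT 𝒯 ΔA κ Fmin
  have hkT : 0 < kT := mul_pos hk hT
  have hlog2 : 0 < Real.log 2 := Real.log_pos one_lt_two
  have hγ0 := ErasureCost.gibbsWeight_pos' kT E 0
  have hΔA : ΔA = -kT * Real.log (ErasureCost.gibbsWeight kT E 0) :=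
    ErasureCost.freeEnergyGap_eq hkT 0
  have hκ : κ = -Real.logb 2 (ErasureCost.gibbsWeight kT E 0) :=
    ErasureCost.reverseEntropy_erasure kT E 0
  have hFmin : Fmin = ErasureCost.gibbsWeight kT E 0 := by
    rw [show Fmin = Real.exp (-ΔA / kT) from rfl, hΔA, neg_mul, neg_neg,
      mul_div_cancel_left₀ _ hkT.ne', Real.exp_log hγ0]
  have hκΔ : κ = ΔA / (kT * Real.log 2) := by
    rw [hκ, hΔA, Real.logb]
    field_simp
  refine ⟨hκΔ, ?_, ?_, ErasureCost.isGreatest_accuracy 0, fun F hF => ?_⟩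
  · rw [hFmin, hκ, neg_neg, Real.rpow_logb two_pos (by norm_num) hγ0]
  · rw [hFmin]
    exact ErasureCost.isGreatest_accuracy_of_minNeqCost hkT hE
  · rw [hFmin] at hF
    have hF0 : 0 < F := hγ0.trans_le hF.1
    obtain ⟨h1, h2⟩ := ErasureCost.isLeast_costs hkT hE hF
    have e1 : 𝒯.neqCostOf kT E F = _ := h1.isGLB.sInf_eq
    have e2 : 𝒯.workCostOf kT E F = _ := h2.isGLB.sInf_eq
    have e3 : Real.logb 2 (F / ErasureCost.gibbsWeight kT E 0) = κ + Real.logb 2 F := by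
      rw [hκ, Real.logb_div hF0.ne' hγ0.ne']
      ring
    refine ⟨e1 ▸ h1, e2 ▸ h2, ?_, ?_, ?_, ?_⟩
    · rw [e1, e3]
    · rw [e1, e3, hκΔ]
    · rw [e1, e2, EReal.coe_mul]
    · rw [e2, e3, hκΔ, Real.logb]
      congr 1
      field_simp
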